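/- Consider the logarithm central force problem $\dot{\mathbf q}=\mathbf p$, $\dot{\mathbf p}=-\mathbf q/|\mathbf q|^2$ on $(\mathbb R^2\setminus\{0\})\times\mathbb R^2$, with energy $H=\tfrac12|\mathbf p|^2+\ln|\mathbf q|$. For $\mathbf p\neq 0$ write $\mathbf q=re^{-1/r^2}(\cos(\varphi+\psi),\sin(\varphi+\psi))$, $\mathbf p=\frac{e^{w}}{r}(\cos\psi,\sin\psi)$ with $r>0$, $\varphi,\psi\in S^1=\mathbb R/2\pi\mathbb Z$, $w\in\mathbb R$, and change time by $d\tau=-r^{-2}e^{1/r^2-w}\,dt$. The equations become $$r'=-\tfrac{r^3}{r^2+2}e^{2w}\cos\varphi,\quad \varphi'=(e^{2w}-r^2)\sin\varphi,\quad \psi'=r^2\sin\varphi,\quad w'=r^2\Bigl(1-\tfrac{e^{2w}}{r^2+2}\Bigr)\cos\varphi ,$$ which extend smoothly to $r=0$. Fix $h\in\mathbb R$ and let $\Sigma_h=\{(r,\varphi,\psi,w)\in[0,\infty)\times S^1\times S^1\times\mathbb R:\ \tfrac12e^{2w}=hr^2-f(r)+1\}$, where $f(r)=r^2\ln r$ for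 $r>0$ and $f(0)=0$. Let $\mathbf N=\{r=0,\ e^{2w}=2\}\subset\Sigma_h$ be the collision manifold. For a flow $\Phi$ on a space $M$ and a set $\mathbf B\subset M$ let $\mathbf b=\partial\mathbf B$; $\mathbf b^{+}$ (resp. $\mathbf b^-$) be the set of $x\in\mathbf b$ such that for some $\varepsilon>0$, $\Phi_t(x)\notin\mathbf B$ for all $t\in(-\varepsilon,0)$ (resp. $t\in(0,\varepsilon)$); $\mathbf a^{+}=\{x\in\mathbf b^+:\Phi_t(x)\in\mathbf B\ \forall t\ge0\}$ and $\mathbf a^{-}=\{x\in\mathbf b^-:\Phi_t(x)\in\mathbf B\ \forall t\le0\}$. The map across $\mathbf B$ is $\Psi(x)=\Phi_{t_{\rm exit}(x)}(x)$ for $x\in\mathbf b^+\setminus\mathbf a^+$, where $t_{\rm exit}(x)=\inf\{t>0:\Phi_t(x)\notin\mathbf B\}$. For $M=\Sigma_h$, $\mathbf B$ is an isolating block if it is compact with non-empty interior, $\mathbf b$ is a smooth surface, and the set of points of $\mathbf b$ at which the vector field is tangent to $\mathbf b$ equals $\mathbf b^+\cap\mathbf b^-$. It isolates $\mathbf N$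 if $\mathbf N$ is compact and invariant, is contained in $\operatorname{int}\mathbf B$, and contains every full orbit that stays in $\operatorname{int}\mathbf B$. It is trivialisable (in the continuous sense) if $\Psi$ extends to a homeomorphism $\mathbf b^+\to\mathbf b^-$. **Theorem.** Let $h\in\mathbb R$. The regularised equations have a unique complete continuous flow $\Phi$ on $\Sigma_h$. For $r>0$ the above change of variables is a homeomorphism onto $\{\mathbf q\ne0,\ \mathbf p\neq0,\ H=h\}$; the set $\{r>0\}$ is invariant under $\Phi$, and there the change of variables transforms $\Phi$ into the logarithm problem up to the change of time. There is $\delta_0=\delta_0(h)>0$ such that for every $\delta\in(0,\delta_0]$ the set $\mathbf B=\{r\le\delta\}\subset\Sigma_h$ is an isolating block that isolates $\mathbf N$, with $$\mathbf b=\{r=\delta\},\quad \mathbf b^{\pm}=\{r=\delta,\ \pm\cos\varphi\ge0\},\quad \mathbf a^+=\{r=\delta,\ \varphi=0\},\quad \mathbf a^-=\{r=\delta,\ \varphi=\pi\},$$ and the map across the block $\Psi$, defined on $\mathbf b^+\setminus\mathbf a^+$, extends to a homeomorphism of $\mathbf b^+$ onto $\mathbf b^-$ that sends $(\delta,0,\psi,w)\in\mathbf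 a^+$ to $(\delta,\pi,\psi,w)\in\mathbf a^-$ for every $\psi\in S^1$. Hence the logarithm central force problem is block regularisable at every energy $h$: the flow of its blow-up on $\Sigma_h$ has an isolating block that isolates the collision manifold $\mathbf N$ and is trivialisable in the continuous sense. -/

import Mathlib

noncomputable section

namespace LogCentralForce

/-! ## The logarithm central force problem -/

/-- The Euclidean plane. -/
abbrev Plane : Type := EuclideanSpace ℝ (Fin 2)

/-- The Hamiltonian `H(q, p) = |p|² / 2 + ln |q|` (meaningful for `q ≠ 0`). -/
def hamiltonian (z : Plane × Plane) : ℝ := ‖z.2‖ ^ 2 / 2 + Real.log ‖z.1‖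

/-- The Hamiltonian vector field `q' = p`, `p' = - q / |q|²` (meaningful for `q ≠ 0`). -/
def logField (z : Plane × Plane) : Plane × Plane := (z.2, -((‖z.1‖ ^ 2)⁻¹ • z.1))

/-! ## The regularised equations -/

/-- The space of the coordinates `(r, φ, ψ, w)`; the two angles live on the circle `ℝ / 2πℤ`. -/
abbrev PhaseSpace : Type := ℝ × Real.Angle × Real.Angle × ℝ

/-- The universal cover of `PhaseSpace`, which is also the space of tangent vectors at any point. -/
abbrev Cover : Type := ℝ × ℝ × ℝ × ℝ

/-- The covering projection. -/
def proj (y : Cover) : PhaseSpace := (y.1, (y.2.1 : Real.Angle), (y.2.2.1 : Real.Angle), y.2.2.2)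

namespace PhaseSpace

/-- The blown-up radius. -/
def r (x : PhaseSpace) : ℝ := x.1

/-- The angle from the velocity to the position. -/
def φ (x : PhaseSpace) : Real.Angle := x.2.1

/-- The polar angle of the velocity. -/
def ψ (x : PhaseSpace) : Real.Angle := x.2.2.1

/-- The logarithm of the rescaled speed. -/
def w (x : PhaseSpace) : ℝ := x.2.2.2

end PhaseSpace

open PhaseSpace

/-- The regularised vector field
`r' = - r³ e^{2w} cos φ / (r² + 2)`, `φ' = (e^{2w} - r²) sin φ`, `ψ' = r² sin φ`,
`w' = r² (1 - e^{2w} / (r² + 2)) cos φ`. -/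
def regField (x : PhaseSpace) : Cover :=
  (-(r x ^ 3 / (r x ^ 2 + 2)) * Real.exp (2 * w x) * (φ x).cos,
    (Real.exp (2 * w x) - r x ^ 2) * (φ x).sin,
    r x ^ 2 * (φ x).sin,
    r x ^ 2 * (1 - Real.exp (2 * w x) / (r x ^ 2 + 2)) * (φ x).cos)

/-- A curve defined for all times solves the regularised equations: it lifts to a differentiable
curve in the cover whose velocity is the vector field. -/
def IsSolution (γ : ℝ → PhaseSpace) : Prop :=
  ∃ c : ℝ → Cover, (∀ t, proj (c t) = γ t) ∧ ∀ t, HasDerivAt c (regField (γ t)) t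

/-- The continuous extension to `r = 0` of `r² ln r`. -/
def energyTerm (s : ℝ) : ℝ := if s = 0 then 0 else s ^ 2 * Real.log s

/-- The energy level `Σ_h = {r ≥ 0, e^{2w} / 2 = h r² - f(r) + 1}`. -/
def energySurface (h : ℝ) : Set PhaseSpace :=
  {x | 0 ≤ r x ∧ Real.exp (2 * w x) / 2 = h * r x ^ 2 - energyTerm (r x) + 1}

/-- A (complete, continuous) flow on `Σ_h` is the flow of the regularised equations. -/
def IsRegularisedFlow (h : ℝ) (Φ : Flow ℝ (energySurface h)) : Prop :=
  ∀ x, IsSolution fun t => (Φ t x : PhaseSpace)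

/-- The collision manifold `N = {r = 0, e^{2w} = 2}`. -/
def collisionManifold (h : ℝ) : Set (energySurface h) :=
  {x | r (x : PhaseSpace) = 0 ∧ Real.exp (2 * w (x : PhaseSpace)) = 2}

/-- The block `B = {r ≤ δ}`. -/
def block (h δ : ℝ) : Set (energySurface h) := {x | r (x : PhaseSpace) ≤ δ}

/-! ## The blow-up and the time change -/

/-- The change of variables `q = r e^{-1/r²} (cos (φ + ψ), sin (φ + ψ))`,
`p = (e^w / r) (cos ψ, sin ψ)`, used for `r > 0`. -/
def blowDown (x : PhaseSpace) : Plane × Plane :=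
  ((r x * Real.exp (-1 / r x ^ 2)) • !₂[(φ x + ψ x).cos, (φ x + ψ x).sin],
    (Real.exp (w x) / r x) • !₂[(ψ x).cos, (ψ x).sin])

/-- The factor `dt / dτ = - r² exp (w - 1 / r²)` of the change of time, used for `r > 0`. -/
def timeFactor (x : PhaseSpace) : ℝ := -(r x ^ 2 * Real.exp (w x - 1 / r x ^ 2))

/-- The flow `Φ` on `Σ_h` arises from the logarithm problem at energy `h` by the blow-up and the
time change: off `r = 0`, the change of variables is a homeomorphism onto the collisionless states
of energy `h` and nonzero momentum, and it carries orbits of `Φ` to orbits of the logarithm problem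
run in the time `t` with `dt = - r² exp (w - 1 / r²) dτ`. -/
def IsBlowUpOfLogProblem (h : ℝ) (Φ : Flow ℝ (energySurface h)) : Prop :=
  (∃ T : {x : energySurface h // 0 < r (x : PhaseSpace)} ≃ₜ
      {z : Plane × Plane // z.1 ≠ 0 ∧ z.2 ≠ 0 ∧ hamiltonian z = h},
    ∀ x, (T x : Plane × Plane) = blowDown x) ∧
  ∀ x : energySurface h, 0 < r (x : PhaseSpace) → ∀ τ : ℝ,
    0 < r (Φ τ x : PhaseSpace) ∧
    HasDerivAt (fun s => blowDown (Φ s x))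
      (timeFactor (Φ τ x) • logField (blowDown (Φ τ x))) τ

/-! ## Isolating blocks and the map across the block -/

section Blocks

variable {M : Type*} [TopologicalSpace M]

/-- `b⁺`: boundary points whose orbit is outside `B` immediately before time `0`. -/
def bPlus (Φ : Flow ℝ M) (B : Set M) : Set M :=
  {x | x ∈ frontier B ∧ ∃ ε > 0, ∀ t ∈ Set.Ioo (-ε) 0, Φ t x ∉ B}

/-- `b⁻`: boundary points whose orbit is outside `B` immediately after time `0`. -/
def bMinus (Φ : Flow ℝ M) (B : Set M) : Set M :=
  {x | x ∈ frontier B ∧ ∃ ε > 0, ∀ t ∈ Set.Ioo 0 ε, Φ t x ∉ B}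

/-- `a⁺`: points of `b⁺` whose forward orbit stays in `B`. -/
def aPlus (Φ : Flow ℝ M) (B : Set M) : Set M :=
  {x | x ∈ bPlus Φ B ∧ ∀ t : ℝ, 0 ≤ t → Φ t x ∈ B}

/-- `a⁻`: points of `b⁻` whose backward orbit stays in `B`. -/
def aMinus (Φ : Flow ℝ M) (B : Set M) : Set M :=
  {x | x ∈ bMinus Φ B ∧ ∀ t : ℝ, t ≤ 0 → Φ t x ∈ B}

/-- The exit time `inf {t > 0 | Φ_t x ∉ B}`, used for `x ∈ b⁺ ∖ a⁺`, where (`B` being closed)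
the set is nonempty. -/
def exitTime (Φ : Flow ℝ M) (B : Set M) (x : M) : ℝ := sInf {t : ℝ | 0 < t ∧ Φ t x ∉ B}

/-- The map across the block, used on `b⁺ ∖ a⁺`. -/
def mapAcross (Φ : Flow ℝ M) (B : Set M) (x : M) : M := Φ (exitTime Φ B x) x

/-- A homeomorphism `b⁺ → b⁻` extends the map across the block. -/
def ExtendsMapAcross (Φ : Flow ℝ M) (B : Set M) (e : bPlus Φ B ≃ₜ bMinus Φ B) : Prop :=
  ∀ x : bPlus Φ B, (x : M) ∉ aPlus Φ B → (e x : M) = mapAcross Φ B x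

/-- `B` is trivialisable (in the continuous sense): the map across the block extends to a
homeomorphism of `b⁺` onto `b⁻`. -/
def IsTrivialisable (Φ : Flow ℝ M) (B : Set M) : Prop :=
  ∃ e : bPlus Φ B ≃ₜ bMinus Φ B, ExtendsMapAcross Φ B e

/-- `U` is an isolating neighbourhood for `N`. -/
def IsIsolatingNhd (Φ : Flow ℝ M) (N U : Set M) : Prop :=
  IsOpen U ∧ N ⊆ U ∧ ∀ x, (∀ t : ℝ, Φ t x ∈ U) → x ∈ N

/-- `N` is an isolated (compact) invariant set. -/
def IsIsolatedInvariant (Φ : Flow ℝ M) (N : Set M) : Prop :=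
  IsCompact N ∧ (∀ x ∈ N, ∀ t : ℝ, Φ t x ∈ N) ∧ ∃ U, IsIsolatingNhd Φ N U

/-- `B` isolates `N`. -/
def Isolates (Φ : Flow ℝ M) (B N : Set M) : Prop :=
  IsIsolatedInvariant Φ N ∧ IsIsolatingNhd Φ N (interior B)

end Blocks

/-- The vectors tangent to `S` at `x`: velocities at `x` of curves in `S`. -/
def tangentVectors (S : Set PhaseSpace) (x : PhaseSpace) : Set Cover :=
  {v | ∃ c : ℝ → Cover, proj (c 0) = x ∧ (∀ᶠ s in nhds 0, proj (c s) ∈ S) ∧ HasDerivAt c v 0}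

/-- `S` is a smooth two-dimensional submanifold of the four-dimensional phase space: locally (in
the cover) it is the zero set of a smooth submersion to the plane. -/
def IsSmoothSurface (S : Set PhaseSpace) : Prop :=
  ∀ y : Cover, proj y ∈ S → ∃ U : Set Cover, IsOpen U ∧ y ∈ U ∧ ∃ g : Cover → ℝ × ℝ,
    ContDiffOn ℝ ((⊤ : ℕ∞) : WithTop ℕ∞) g U ∧ Function.Surjective (fderiv ℝ g y) ∧
    ∀ z ∈ U, proj z ∈ S ↔ g z = 0

/-- `t`: the boundary points of `B` at which the vector field is tangent to the boundary. -/
def tangencySet {h : ℝ} (B : Set (energySurface h)) : Set (energySurface h) :=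
  {x | x ∈ frontier B ∧
    regField x ∈ tangentVectors ((fun y : energySurface h => (y : PhaseSpace)) '' frontier B) x}

/-- `B` is an isolating block: compact, with nonempty interior, with boundary a smooth hypersurface
(of dimension two) of the energy level, and with `t = b⁺ ∩ b⁻`. -/
def IsIsolatingBlock {h : ℝ} (Φ : Flow ℝ (energySurface h)) (B : Set (energySurface h)) : Prop :=
  IsCompact B ∧ (interior B).Nonempty ∧
  IsSmoothSurface ((fun y : energySurface h => (y : PhaseSpace)) '' frontier B) ∧
  tangencySet B = bPlus Φ B ∩ bMinus Φ B

/-- The logarithm central force problem is block regularisable at energy `h`: its blow-up has a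
complete flow on `Σ_h`, with a trivialisable isolating block that isolates the collision
manifold. -/
def IsBlockRegularisable (h : ℝ) : Prop :=
  ∃ Φ : Flow ℝ (energySurface h), IsRegularisedFlow h Φ ∧ IsBlowUpOfLogProblem h Φ ∧
    ∃ B : Set (energySurface h), IsIsolatingBlock Φ B ∧
      Isolates Φ B (collisionManifold h) ∧ IsTrivialisable Φ B

end LogCentralForce

end

/-!
The set `r = 0` of the energy level is invariant, and near it the equations are governed by two
first integrals: the energy, which makes `e^{2w}` a function `kinetic h r` of `r` with value `2` at
`r = 0`, and the angular momentum `e^{w - 1/r²} sin φ`, whose square is `κ(r) sin² φ` with `κ`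
strictly increasing on `[0, δ]` (`IsSmall.strictMonoOn_kappa`) as soon as `e^{2w} > r²` there.

*The flow.* On the energy level `r` is bounded and `w` is bounded above, so the vector field may be
cut off outside this region. The cut-off field is bounded and globally Lipschitz, hence has a global
flow depending continuously on the initial point (Picard–Lindelöf and Grönwall). As the cut-off
field is a multiple of the original one, the energy relation is preserved, and on the energy level
the cutoff is invisible (`exists_trajectories`, `existsUnique_flow`).

*The block.* For `0 < φ < π` the angle `φ` increases inside `{r ≤ δ}`, and `r' < 0` or `r' > 0`
according to the sign of `cos φ`. If `sin φ ≠ 0`, conservation of angular momentum bounds `|sin φ|`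
from below in the block, so the orbit must leave it (`IsTraj.exists_exit`). If `sin φ = 0`, the
angle is constant, `r` is monotone, and the orbit leaves the block in one direction of time
(`IsTraj.exists_exit_of_cos_neg`). This gives `b^±`, `a^±` and the isolation of the collision
manifold; statements about the past follow from those about the future by the reversibility
`(φ, ψ, t) ↦ (π - φ, -ψ, -t)`.

*The map across the block.* An orbit that enters with `φ = a` must leave with `sin φ = sin a`, that
is, with `φ = π - a` (`IsTraj.crossing`). Since `dψ/dφ = r² / (e^{2w} - r²)` is a continuous
function `F` of `κ(r) = κ(δ) sin² a / sin² φ`, the angle `ψ` changes by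
`Δ(a) = ∫ F (κ(δ) sin² a / sin² φ) dφ` over `[a, π - a]`. As `a → 0` the argument of `F` tends to
`0` for each `φ` in `(0, π)`, and `F(0) = 0`; dominated convergence gives the continuity of `Δ` and
`Δ(0) = 0` (`continuous_scatter`, `turning_zero`). Hence `(φ, ψ) ↦ (π - φ, ψ + Δ(φ))` is the
required homeomorphism, with the explicit inverse `(φ, ψ) ↦ (π - φ, ψ - Δ(π - φ))`.
-/

/-! ### Global flows of bounded Lipschitz vector fields -/

namespace LogCentralForce

open scoped NNReal Topology

section GlobalFlow

variable {E : Type*} [NormedAddCommGroup E] [NormedSpace ℝ E]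

/-- Picard–Lindelöf on an interval of arbitrary length: a bounded field admits a closed ball that no
solution leaves before the given time. -/
theorem exists_solution_on_Ioo [CompleteSpace E] {v : E → E} {K L : ℝ≥0} (hv : LipschitzWith K v)
    (hL : ∀ x, ‖v x‖ ≤ L) (y : E) (a : ℝ≥0) :
    ∃ c : ℝ → E, c 0 = y ∧ ∀ t ∈ Set.Ioo (-(a : ℝ)) a, HasDerivAt c (v (c t)) t := by
  have h0 : (0 : ℝ) ∈ Set.Icc (-(a : ℝ)) a := by simp
  have hP : IsPicardLindelof (fun _ => v) (⟨0, h0⟩ : Set.Icc (-(a : ℝ)) a) y (L * a) 0 L K :=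
    { lipschitzOnWith := fun _ _ => hv.lipschitzOnWith
      continuousOn := fun _ _ => continuousOn_const
      norm_le := fun _ _ x _ => hL x
      mul_max_le := by simp }
  obtain ⟨c, hc0, hc⟩ := hP.exists_eq_forall_mem_Icc_hasDerivWithinAt₀
  exact ⟨c, hc0, fun t ht => (hc t (Set.Ioo_subset_Icc_self ht)).hasDerivAt
    (Icc_mem_nhds ht.1 ht.2)⟩

theorem exists_global_solution [CompleteSpace E] {v : E → E} {K L : ℝ≥0} (hv : LipschitzWith K v)
    (hL : ∀ x, ‖v x‖ ≤ L) (y : E) :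
    ∃ c : ℝ → E, c 0 = y ∧ ∀ t, HasDerivAt c (v (c t)) t := by
  choose α hα0 hα using exists_solution_on_Ioo hv hL y
  have key : ∀ a b : ℝ≥0, a ≤ b → ∀ t ∈ Set.Ioo (-(a : ℝ)) a, α a t = α b t := by
    intro a b hab t ht
    have hab' : (a : ℝ) ≤ b := hab
    have ha : (0 : ℝ) < a := by linarith [ht.1, ht.2]
    exact ODE_solution_unique_of_mem_Ioo (v := fun _ => v) (s := fun _ => Set.univ) (K := K)
      (t₀ := 0) (fun _ _ => hv.lipschitzOnWith) (by simpa using ha)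
      (fun t ht => ⟨hα a t ht, trivial⟩)
      (fun t ht => ⟨hα b t ⟨by linarith [ht.1], by linarith [ht.2]⟩, trivial⟩)
      ((hα0 a).trans (hα0 b).symm) ht
  -- At time `t`, take the solution on `(-(|t| + 1), |t| + 1)`.
  refine ⟨fun t => α (‖t‖₊ + 1) t, hα0 _, fun t => ?_⟩
  have hmem : t ∈ Set.Ioo (-((‖t‖₊ + 1 : ℝ≥0) : ℝ)) ((‖t‖₊ + 1 : ℝ≥0) : ℝ) := by
    simp only [NNReal.coe_add, coe_nnnorm, Real.norm_eq_abs, NNReal.coe_one, Set.mem_Ioo]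
    constructor <;> linarith [neg_abs_le t, le_abs_self t]
  refine (hα _ t hmem).congr_of_eventuallyEq ?_
  filter_upwards [Ioo_mem_nhds hmem.1 hmem.2] with s hs
  have hs' : s ∈ Set.Ioo (-((‖s‖₊ + 1 : ℝ≥0) : ℝ)) ((‖s‖₊ + 1 : ℝ≥0) : ℝ) := by
    simp only [NNReal.coe_add, coe_nnnorm, Real.norm_eq_abs, NNReal.coe_one, Set.mem_Ioo]
    constructor <;> linarith [neg_abs_le s, le_abs_self s]
  rcases le_total (‖s‖₊ + 1) (‖t‖₊ + 1) with hst | hst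
  · exact key _ _ hst s hs'
  · exact (key _ _ hst s hs).symm

theorem dist_solution_le {v : E → E} {K : ℝ≥0} (hv : LipschitzWith K v) {c d : ℝ → E}
    (hc : ∀ t, HasDerivAt c (v (c t)) t) (hd : ∀ t, HasDerivAt d (v (d t)) t) (t : ℝ) :
    dist (c t) (d t) ≤ dist (c 0) (d 0) * Real.exp (K * |t|) := by
  -- The forward estimate, for an arbitrary field so that it also serves the reversed one.
  have fwd : ∀ {v : E → E} {c d : ℝ → E}, LipschitzWith K v → (∀ t, HasDerivAt c (v (c t)) t) →
      (∀ t, HasDerivAt d (v (d t)) t) → ∀ t, 0 ≤ t →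
      dist (c t) (d t) ≤ dist (c 0) (d 0) * Real.exp (K * t) := by
    intro v c d hv hc hd t ht
    have := dist_le_of_trajectories_ODE (v := fun _ => v) (K := K) (a := 0) (b := t) (fun _ => hv)
      (fun s _ => (hc s).continuousAt.continuousWithinAt) (fun s _ => (hc s).hasDerivWithinAt)
      (fun s _ => (hd s).continuousAt.continuousWithinAt) (fun s _ => (hd s).hasDerivWithinAt)
      le_rfl t ⟨ht, le_rfl⟩
    simpa using this
  have rev : ∀ {c : ℝ → E}, (∀ t, HasDerivAt c (v (c t)) t) →
      ∀ t, HasDerivAt (fun s => c (-s)) ((fun x => -v x) (c (-t))) t := by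
    intro c hc t
    simpa [Function.comp_def] using (hc (-t)).scomp t (hasDerivAt_neg t)
  rcases le_total 0 t with ht | ht
  · rw [abs_of_nonneg ht]; exact fwd hv hc hd t ht
  · rw [abs_of_nonpos ht]
    simpa using fwd hv.neg (rev hc) (rev hd) (-t) (by linarith)

end GlobalFlow

/-- Solutions of the scalar equation `u' = k(t) u` are `u(0)` times a positive function; in
particular `u` vanishes identically or never, and keeps its sign. -/
theorem exists_pos_factor {u k : ℝ → ℝ} (hk : Continuous k)
    (hu : ∀ t, HasDerivAt u (k t * u t) t) :
    ∃ m : ℝ → ℝ, (∀ t, 0 < m t) ∧ ∀ t, u t = u 0 * m t := by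
  refine ⟨fun t => Real.exp (∫ s in (0 : ℝ)..t, k s), fun t => Real.exp_pos _, fun t => ?_⟩
  have hI : ∀ t, HasDerivAt (fun t => ∫ s in (0 : ℝ)..t, k s) (k t) t := fun t =>
    intervalIntegral.integral_hasDerivAt_right (hk.intervalIntegrable _ _)
      (hk.stronglyMeasurableAtFilter _ _) hk.continuousAt
  have hd : ∀ t, HasDerivAt (fun t => u t * Real.exp (-∫ s in (0 : ℝ)..t, k s)) 0 t := by
    intro t
    exact ((hu t).mul (hI t).neg.exp).congr_deriv (by ring)
  have := is_const_of_deriv_eq_zero (fun t => (hd t).differentiableAt) (fun t => (hd t).deriv) t 0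
  simp only [Real.exp_neg, intervalIntegral.integral_same, Real.exp_zero, inv_one, mul_one] at this
  rw [← this]
  field_simp

end LogCentralForce

/-! ### The regularised vector field on the universal cover -/

namespace LogCentralForce

open scoped NNReal Topology

/-- The regularised vector field, lifted to the universal cover. -/
noncomputable def coverField (y : Cover) : Cover :=
  (-(y.1 ^ 3 / (y.1 ^ 2 + 2)) * Real.exp (2 * y.2.2.2) * Real.cos y.2.1,
    (Real.exp (2 * y.2.2.2) - y.1 ^ 2) * Real.sin y.2.1,
    y.1 ^ 2 * Real.sin y.2.1,
    y.1 ^ 2 * (1 - Real.exp (2 * y.2.2.2) / (y.1 ^ 2 + 2)) * Real.cos y.2.1)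

theorem regField_proj (y : Cover) : regField (proj y) = coverField y := rfl

theorem hasDerivAt_cover {c : ℝ → Cover} {v : Cover} {t : ℝ} :
    HasDerivAt c v t ↔ HasDerivAt (fun s => (c s).1) v.1 t ∧
      HasDerivAt (fun s => (c s).2.1) v.2.1 t ∧ HasDerivAt (fun s => (c s).2.2.1) v.2.2.1 t ∧
      HasDerivAt (fun s => (c s).2.2.2) v.2.2.2 t := by
  refine ⟨fun h => ?_, fun ⟨h1, h2, h3, h4⟩ => h1.prodMk (h2.prodMk (h3.prodMk h4))⟩
  refine ⟨?_, ?_, ?_, ?_⟩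
  · simpa using (h.hasFDerivAt.fst).hasDerivAt
  · simpa using (h.hasFDerivAt.snd.fst).hasDerivAt
  · simpa using (h.hasFDerivAt.snd.snd.fst).hasDerivAt
  · simpa using (h.hasFDerivAt.snd.snd.snd).hasDerivAt

/-! ### Cutting the vector field off -/

/-- A Lipschitz cutoff, equal to `1` on `{|r| ≤ R, w ≤ W}` and to `0` off
`{|r| < R + 1, w < W + 1}`. -/
noncomputable def cutoff (R W : ℝ) (y : Cover) : ℝ :=
  max (min 1 (min (R + 1 - |y.1|) (W + 1 - y.2.2.2))) 0

theorem cutoff_eq_one {R W : ℝ} {y : Cover} (hr : |y.1| ≤ R) (hw : y.2.2.2 ≤ W) :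
    cutoff R W y = 1 := by
  unfold cutoff
  rw [min_eq_left (le_min (by linarith) (by linarith)), max_eq_left zero_le_one]

theorem cutoff_eq_zero_of_left {R W : ℝ} {y : Cover} (hr : R + 1 ≤ |y.1|) : cutoff R W y = 0 :=
  max_eq_right ((min_le_right _ _).trans ((min_le_left _ _).trans (by linarith)))

theorem cutoff_eq_zero_of_right {R W : ℝ} {y : Cover} (hw : W + 1 ≤ y.2.2.2) : cutoff R W y = 0 :=
  max_eq_right ((min_le_right _ _).trans ((min_le_right _ _).trans (by linarith)))

theorem lipschitz_coord_one : LipschitzWith 1 fun y : Cover => y.1 := LipschitzWith.prod_fst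

theorem lipschitz_coord_two : LipschitzWith 1 fun y : Cover => y.2.1 := by
  simpa [Function.comp_def] using
    (LipschitzWith.prod_fst (α := ℝ) (β := ℝ × ℝ)).comp (LipschitzWith.prod_snd (α := ℝ))

theorem lipschitz_coord_four : LipschitzWith 1 fun y : Cover => y.2.2.2 := by
  simpa [Function.comp_def] using ((LipschitzWith.prod_snd (α := ℝ) (β := ℝ)).comp
    LipschitzWith.prod_snd).comp (LipschitzWith.prod_snd (α := ℝ) (β := ℝ × ℝ × ℝ))

theorem exists_lipschitzWith_cutoff (R W : ℝ) : ∃ K, LipschitzWith K (cutoff R W) := by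
  have h1 : LipschitzWith (0 + 1) fun y : Cover => R + 1 - |y.1| := by
    simpa using (LipschitzWith.const (R + 1)).sub (lipschitzWith_one_norm.comp lipschitz_coord_one)
  have h2 : LipschitzWith (0 + 1) fun y : Cover => W + 1 - y.2.2.2 :=
    (LipschitzWith.const (W + 1)).sub lipschitz_coord_four
  exact ⟨_, ((h1.min h2).const_min 1).max_const 0⟩

/-- The vector field as a smooth function of `(r, cos φ, sin φ, e^{2w})` and of a factor. -/
noncomputable def polyField (p : ℝ × ℝ × ℝ × ℝ × ℝ) : Cover :=
  p.2.2.2.2 • (-(p.1 ^ 3 / (p.1 ^ 2 + 2)) * p.2.2.2.1 * p.2.1,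
    (p.2.2.2.1 - p.1 ^ 2) * p.2.2.1,
    p.1 ^ 2 * p.2.2.1,
    p.1 ^ 2 * (1 - p.2.2.2.1 / (p.1 ^ 2 + 2)) * p.2.1)

theorem contDiff_polyField : ContDiff ℝ 1 polyField := by
  have hne : ∀ p : ℝ × ℝ × ℝ × ℝ × ℝ, p.1 ^ 2 + 2 ≠ 0 := fun p => by positivity
  have h1 : ContDiff ℝ 1 fun p : ℝ × ℝ × ℝ × ℝ × ℝ => p.1 ^ 3 / (p.1 ^ 2 + 2) :=
    ContDiff.div (by fun_prop) (by fun_prop) hne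
  have h2 : ContDiff ℝ 1 fun p : ℝ × ℝ × ℝ × ℝ × ℝ => p.2.2.2.1 / (p.1 ^ 2 + 2) :=
    ContDiff.div (by fun_prop) (by fun_prop) hne
  unfold polyField
  fun_prop

/-- The arguments of `polyField`, truncated so as to stay in a compact set. -/
noncomputable def truncation (R W : ℝ) (y : Cover) : ℝ × ℝ × ℝ × ℝ × ℝ :=
  (max (min (R + 1) y.1) (-(R + 1)), Real.cos y.2.1, Real.sin y.2.1,
    Real.exp (2 * min (W + 1) y.2.2.2), cutoff R W y)

theorem exists_lipschitzWith_truncation (R W : ℝ) : ∃ K, LipschitzWith K (truncation R W) := by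
  obtain ⟨K, hK⟩ := exists_lipschitzWith_cutoff R W
  have h1 := (lipschitz_coord_one.const_min (R + 1)).max_const (-(R + 1))
  have h2 := Real.lipschitzWith_cos.comp lipschitz_coord_two
  have h3 := Real.lipschitzWith_sin.comp lipschitz_coord_two
  have hexp : LipschitzOnWith (2 * Real.exp (2 * (W + 1))).toNNReal
      (fun w : ℝ => Real.exp (2 * w)) (Set.Iic (W + 1)) := by
    have hd : ∀ x : ℝ, HasDerivAt (fun w : ℝ => Real.exp (2 * w)) (2 * Real.exp (2 * x)) x := by
      intro x
      exact (((hasDerivAt_id x).const_mul 2).exp).congr_deriv (by simp; ring)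
    refine Convex.lipschitzOnWith_of_nnnorm_deriv_le (fun x _ => (hd x).differentiableAt)
      (fun x hx => ?_) (convex_Iic _)
    rw [(hd x).deriv, ← NNReal.coe_le_coe, coe_nnnorm, Real.norm_of_nonneg (by positivity),
      Real.coe_toNNReal _ (by positivity)]
    have : x ≤ W + 1 := hx
    gcongr
  have h4 := hexp.comp (g := fun w : ℝ => Real.exp (2 * w)) (s := Set.univ)
    (lipschitz_coord_four.const_min (W + 1)).lipschitzOnWith
    (fun y _ => Set.mem_Iic.2 (min_le_left _ _))
  exact ⟨_, h1.prodMk (h2.prodMk (h3.prodMk ((lipschitzOnWith_univ.1 h4).prodMk hK)))⟩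

theorem exists_truncation_mem (R W : ℝ) :
    ∃ C : ℝ, ∀ y, truncation R W y ∈ Metric.closedBall (0 : ℝ × ℝ × ℝ × ℝ × ℝ) C := by
  refine ⟨max |R + 1| (max 1 (Real.exp (2 * (W + 1)))), fun y => ?_⟩
  rw [mem_closedBall_zero_iff]
  simp only [truncation, Prod.norm_def, Real.norm_eq_abs]
  refine max_le ?_ (max_le ?_ (max_le ?_ (max_le ?_ ?_)))
  · refine le_max_of_le_left (abs_le.2 ⟨?_, ?_⟩)
    · exact le_max_of_le_right (by linarith [le_abs_self (R + 1)])
    · exact max_le ((min_le_left _ _).trans (le_abs_self _)) (neg_le_abs _)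
  · exact le_max_of_le_right (le_max_of_le_left (Real.abs_cos_le_one _))
  · exact le_max_of_le_right (le_max_of_le_left (Real.abs_sin_le_one _))
  · refine le_max_of_le_right (le_max_of_le_right ?_)
    rw [abs_of_pos (Real.exp_pos _)]
    gcongr
    exact min_le_left _ _
  · refine le_max_of_le_right (le_max_of_le_left ?_)
    rw [cutoff, abs_of_nonneg (le_max_right _ _)]
    exact max_le (min_le_left _ _) zero_le_one

/-- The truncations are invisible where the cutoff does not vanish. -/
theorem polyField_truncation (R W : ℝ) (y : Cover) :
    polyField (truncation R W y) = cutoff R W y • coverField y := by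
  by_cases h : cutoff R W y = 0
  · simp [polyField, truncation, h]
  · have hr : |y.1| < R + 1 := not_le.1 fun h' => h (cutoff_eq_zero_of_left h')
    have hw : y.2.2.2 < W + 1 := not_le.1 fun h' => h (cutoff_eq_zero_of_right h')
    have h1 : max (min (R + 1) y.1) (-(R + 1)) = y.1 := by
      rw [min_eq_right (by linarith [le_abs_self y.1]),
        max_eq_left (by linarith [neg_abs_le y.1])]
    have h2 : min (W + 1) y.2.2.2 = y.2.2.2 := min_eq_right hw.le
    simp only [polyField, truncation, h1, h2, coverField]

theorem exists_lipschitz_bounded_cutoff_field (R W : ℝ) :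
    ∃ K L : ℝ≥0, LipschitzWith K (fun y => cutoff R W y • coverField y) ∧
      ∀ y, ‖cutoff R W y • coverField y‖ ≤ L := by
  obtain ⟨K₁, hK₁⟩ := exists_lipschitzWith_truncation R W
  obtain ⟨C, hC⟩ := exists_truncation_mem R W
  have hcomp := isCompact_closedBall (0 : ℝ × ℝ × ℝ × ℝ × ℝ) C
  obtain ⟨K₂, hK₂⟩ := LocallyLipschitzOn.exists_lipschitzOnWith_of_compact hcomp
    (contDiff_polyField.locallyLipschitz.locallyLipschitzOn (s := Metric.closedBall 0 C))
  obtain ⟨L, hL⟩ := hcomp.exists_bound_of_continuousOn contDiff_polyField.continuous.continuousOn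
  have h := hK₂.comp (s := Set.univ) hK₁.lipschitzOnWith (fun y _ => hC y)
  refine ⟨K₂ * K₁, L.toNNReal, ?_, fun y => ?_⟩
  · have := lipschitzOnWith_univ.1 h
    simpa only [Function.comp_def, polyField_truncation] using this
  · rw [← polyField_truncation]
    exact (hL _ (hC y)).trans (Real.le_coe_toNNReal L)

end LogCentralForce

/-! ### Energy conservation and trajectories -/

namespace LogCentralForce

open scoped NNReal Topology
open PhaseSpace

/-- The value of `e^{2w}` on the energy level `Σ_h`, as a function of `r`. -/
noncomputable def kinetic (h s : ℝ) : ℝ := 2 * (h * s ^ 2 - s ^ 2 * Real.log s + 1)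

theorem mem_energySurface_iff {h : ℝ} {x : PhaseSpace} :
    x ∈ energySurface h ↔ 0 ≤ r x ∧ Real.exp (2 * w x) = kinetic h (r x) := by
  have : energyTerm (r x) = r x ^ 2 * Real.log (r x) := by
    unfold energyTerm
    split_ifs with h0 <;> simp [h0]
  simp only [energySurface, Set.mem_ofPred_eq, kinetic, this]
  refine and_congr_right fun _ => ⟨fun h => by linarith, fun h => by linarith⟩

theorem continuous_kinetic (h : ℝ) : Continuous (kinetic h) := by
  have : kinetic h = fun s => 2 * (h * s ^ 2 - s * (s * Real.log s) + 1) := by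
    funext s; unfold kinetic; ring
  rw [this]
  have := Real.continuous_mul_log
  fun_prop

theorem kinetic_zero (h : ℝ) : kinetic h 0 = 2 := by simp [kinetic]

theorem hasDerivAt_kinetic (h : ℝ) {s : ℝ} (hs : 0 < s) :
    HasDerivAt (kinetic h) (2 * (kinetic h s - 2 - s ^ 2) / s) s := by
  have h2 := hasDerivAt_pow 2 s
  refine (((h2.const_mul h).sub (h2.mul (Real.hasDerivAt_log hs.ne'))).add_const 1
    |>.const_mul 2).congr_deriv ?_
  unfold kinetic
  field_simp
  push_cast
  ring

/-- The energy level is bounded in the direction of `r`, and bounded above in that of `w`. -/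
theorem exists_bounds (h : ℝ) :
    ∃ R W : ℝ, ∀ x ∈ energySurface h, |r x| ≤ R ∧ w x ≤ W := by
  have hR : ∀ x ∈ energySurface h, r x ≤ max 1 (Real.exp (h + 1)) := by
    intro x hx
    obtain ⟨h0, hE⟩ := mem_energySurface_iff.1 hx
    by_contra! hlt
    have h1 : 1 < r x := (le_max_left _ _).trans_lt hlt
    have h2 : h + 1 < Real.log (r x) :=
      (Real.lt_log_iff_exp_lt (by linarith)).2 ((le_max_right _ _).trans_lt hlt)
    have h3 : 0 < kinetic h (r x) := hE ▸ Real.exp_pos _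
    unfold kinetic at h3
    nlinarith [mul_lt_mul_of_pos_left h2 (by positivity : 0 < r x ^ 2)]
  obtain ⟨C, hC⟩ := (isCompact_Icc (a := (0 : ℝ)) (b := max 1 (Real.exp (h + 1)))).bddAbove_image
    (continuous_kinetic h).continuousOn
  refine ⟨max 1 (Real.exp (h + 1)), C, fun x hx => ?_⟩
  obtain ⟨h0, hE⟩ := mem_energySurface_iff.1 hx
  refine ⟨by rw [abs_of_nonneg h0]; exact hR x hx, ?_⟩
  have h1 : kinetic h (r x) ≤ C := hC ⟨r x, ⟨h0, hR x hx⟩, rfl⟩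
  have h2 := Real.add_one_le_exp (2 * w x)
  -- `2 w + 1 ≤ e^{2w} ≤ C` and `C > 0` give `w ≤ C`.
  have h3 := Real.exp_pos (2 * w x)
  linarith

/-- A curve in the cover that solves the lifted equations and projects to the energy level. -/
structure IsTraj (h : ℝ) (c : ℝ → Cover) : Prop where
  mem : ∀ t, proj (c t) ∈ energySurface h
  deriv : ∀ t, HasDerivAt c (coverField (c t)) t

/-- The energy level is invariant under the cut-off equations: off `r = 0` the defect of the energy
relation solves a homogeneous linear equation along each solution, and at `r = 0` the
field is tangent to `{r = 0}` and leaves `w` unchanged. -/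
theorem mem_energySurface_of_solution {h : ℝ} {χ : ℝ → ℝ} {c : ℝ → Cover} (hχ : Continuous χ)
    (hc : ∀ t, HasDerivAt c (χ t • coverField (c t)) t) (h0 : proj (c 0) ∈ energySurface h)
    (t : ℝ) : proj (c t) ∈ energySurface h := by
  have hcc : Continuous c := continuous_iff_continuousAt.2 fun t => (hc t).continuousAt
  have hd := fun t => hasDerivAt_cover.1 (hc t)
  simp only [coverField, Prod.smul_fst, Prod.smul_snd, smul_eq_mul] at hd
  have hne : ∀ t, (c t).1 ^ 2 + 2 ≠ 0 := fun t => by positivity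
  obtain ⟨hr0, hE0⟩ := mem_energySurface_iff.1 h0
  simp only [proj, r, w] at hr0 hE0
  obtain ⟨m, hm, hrm⟩ := exists_pos_factor (u := fun t => (c t).1)
    (k := fun t => -(χ t * ((c t).1 ^ 2 / ((c t).1 ^ 2 + 2) * Real.exp (2 * (c t).2.2.2)
      * Real.cos (c t).2.1)))
    (by fun_prop (disch := exact hne)) (fun t => by
      refine (hd t).1.congr_deriv ?_
      have := hne t
      field_simp)
  rw [mem_energySurface_iff]
  simp only [proj, r, w]
  have hdE : ∀ t, HasDerivAt (fun s => Real.exp (2 * (c s).2.2.2)) _ t :=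
    fun t => ((hd t).2.2.2.const_mul 2).exp
  rcases hr0.eq_or_lt with hr | hr
  · have hz : ∀ t, (c t).1 = 0 := fun t => by rw [hrm t, ← hr, zero_mul]
    have := is_const_of_deriv_eq_zero (fun t => (hdE t).differentiableAt)
      (fun t => (hdE t).deriv.trans (by simp [hz])) t 0
    rw [this, hE0, hz, hz]
    exact ⟨le_rfl, rfl⟩
  · have hpos : ∀ t, 0 < (c t).1 := fun t => by rw [hrm t]; exact mul_pos hr (hm t)
    obtain ⟨m', -, hG⟩ := exists_pos_factor
      (u := fun t => Real.exp (2 * (c t).2.2.2) - kinetic h (c t).1)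
      (k := fun t => -(χ t * (2 * (c t).1 ^ 2 / ((c t).1 ^ 2 + 2) * Real.exp (2 * (c t).2.2.2)
        * Real.cos (c t).2.1)))
      (by fun_prop (disch := exact hne)) (fun t => by
        have h1 := (hdE t).sub ((hasDerivAt_kinetic h (hpos t)).comp t (hd t).1)
        refine h1.congr_deriv ?_
        have := hne t
        have := (hpos t).ne'
        field_simp
        ring)
    have := hG t
    simp only [hE0, sub_self, zero_mul] at this
    exact ⟨(hpos t).le, by linarith⟩

theorem IsTraj.continuous {h : ℝ} {c : ℝ → Cover} (hc : IsTraj h c) : Continuous c :=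
  continuous_iff_continuousAt.2 fun t => (hc.deriv t).continuousAt

/-- Trajectories through every point of the energy level exist for all times, are unique, and
depend Lipschitz continuously on the initial point. -/
theorem exists_trajectories (h : ℝ) :
    (∀ y, proj y ∈ energySurface h → ∃ c, c 0 = y ∧ IsTraj h c) ∧
    ∃ K : ℝ≥0, ∀ c d, IsTraj h c → IsTraj h d →
      ∀ t, dist (c t) (d t) ≤ dist (c 0) (d 0) * Real.exp (K * |t|) := by
  obtain ⟨R, W, hRW⟩ := exists_bounds h
  obtain ⟨K, L, hK, hL⟩ := exists_lipschitz_bounded_cutoff_field R W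
  have hone : ∀ y, proj y ∈ energySurface h → cutoff R W y = 1 := fun y hy =>
    cutoff_eq_one (hRW _ hy).1 (hRW _ hy).2
  refine ⟨fun y hy => ?_, K, fun c d hc hd t => ?_⟩
  · obtain ⟨c, hc0, hc⟩ := exists_global_solution hK hL y
    have hcc : Continuous c := continuous_iff_continuousAt.2 fun t => (hc t).continuousAt
    obtain ⟨K', hK'⟩ := exists_lipschitzWith_cutoff R W
    have hmem := mem_energySurface_of_solution (hK'.continuous.comp hcc) hc (hc0 ▸ hy)
    exact ⟨c, hc0, hmem, fun t => by simpa [hone _ (hmem t)] using hc t⟩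
  · exact dist_solution_le hK
      (fun t => by simpa [hone _ (hc.mem t)] using hc.deriv t)
      (fun t => by simpa [hone _ (hd.mem t)] using hd.deriv t) t

theorem IsTraj.eq_of_eq_zero {h : ℝ} {c d : ℝ → Cover} (hc : IsTraj h c) (hd : IsTraj h d)
    (h0 : c 0 = d 0) : c = d := by
  obtain ⟨-, K, hK⟩ := exists_trajectories h
  funext t
  have := hK c d hc hd t
  rw [h0, dist_self, zero_mul] at this
  exact dist_le_zero.1 this

theorem IsTraj.comp_add {h : ℝ} {c : ℝ → Cover} (hc : IsTraj h c) (a : ℝ) :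
    IsTraj h fun t => c (t + a) :=
  ⟨fun _ => hc.mem _, fun t => (hc.deriv (t + a)).comp_add_const t a⟩

/-- The difference of two points of the cover with the same projection acts on trajectories. -/
theorem IsTraj.deck {h : ℝ} {c : ℝ → Cover} (hc : IsTraj h c) {a b : Cover}
    (hab : proj a = proj b) : IsTraj h fun t => c t + (b - a) := by
  have hp : ∀ y, proj (y + (b - a)) = proj y := by
    intro y
    simp only [proj, Prod.mk.injEq] at hab ⊢
    simp only [Prod.fst_add, Prod.snd_add, Prod.fst_sub, Prod.snd_sub, Real.Angle.coe_add,
      Real.Angle.coe_sub, hab, sub_self, add_zero, and_self]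
  refine ⟨fun t => by rw [hp]; exact hc.mem t, fun t => ?_⟩
  rw [← regField_proj, hp, regField_proj]
  exact (hc.deriv t).add_const _

theorem IsTraj.proj_eq {h : ℝ} {c d : ℝ → Cover} (hc : IsTraj h c) (hd : IsTraj h d)
    (h0 : proj (c 0) = proj (d 0)) (t : ℝ) : proj (c t) = proj (d t) := by
  have := congrFun ((hc.deck h0).eq_of_eq_zero hd (by simp)) t
  rw [← this]
  have hp : proj (c t) = proj (c t + (d 0 - c 0)) := by
    simp only [proj, Prod.mk.injEq] at h0 ⊢
    simp only [Prod.fst_add, Prod.snd_add, Prod.fst_sub, Prod.snd_sub, Real.Angle.coe_add,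
      Real.Angle.coe_sub, h0, sub_self, add_zero, and_self]
  exact hp

end LogCentralForce

/-! ### The flow on the energy level -/

namespace LogCentralForce

open scoped NNReal Topology
open PhaseSpace

theorem continuous_proj : Continuous proj := by
  have := Real.Angle.continuous_coe
  unfold proj
  fun_prop

theorem continuousAt_toReal {θ : Real.Angle} (hθ : θ ≠ (Real.pi : Real.Angle)) :
    ContinuousAt Real.Angle.toReal θ := by
  induction θ using Real.Angle.induction_on with
  | h x =>
    have hx : ¬ x ≡ -Real.pi [PMOD (2 * Real.pi)] := by
      intro hmod
      apply hθ
      rw [Real.Angle.angle_eq_iff_two_pi_dvd_sub]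
      obtain ⟨m, hm⟩ := AddCommGroup.modEq_iff_zsmul'.1 hmod
      refine ⟨-m - 1, ?_⟩
      rw [zsmul_eq_mul] at hm
      push_cast
      linarith
    exact QuotientAddGroup.isOpenQuotientMap_mk.continuousAt_comp_iff.1
      (continuousAt_toIocMod Real.two_pi_pos (-Real.pi) hx)

/-- A lift to the cover of the points of phase space, continuous at `x₀`. -/
noncomputable def liftNear (x₀ x : PhaseSpace) : Cover :=
  (x.1, (φ x₀).toReal + (φ x - φ x₀).toReal, (ψ x₀).toReal + (ψ x - ψ x₀).toReal, x.2.2.2)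

theorem proj_liftNear (x₀ x : PhaseSpace) : proj (liftNear x₀ x) = x := by
  simp [proj, liftNear, φ, ψ]

theorem continuousAt_liftNear (x₀ : PhaseSpace) : ContinuousAt (liftNear x₀) x₀ := by
  have h0 : (0 : Real.Angle) ≠ (Real.pi : Real.Angle) := Real.Angle.pi_ne_zero.symm
  have h1 : ContinuousAt (fun x : PhaseSpace => (φ x - φ x₀).toReal) x₀ :=
    ContinuousAt.comp (g := Real.Angle.toReal) (continuousAt_toReal (by simpa using h0))
      (by unfold φ; fun_prop)
  have h2 : ContinuousAt (fun x : PhaseSpace => (ψ x - ψ x₀).toReal) x₀ :=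
    ContinuousAt.comp (g := Real.Angle.toReal) (continuousAt_toReal (by simpa using h0))
      (by unfold ψ; fun_prop)
  unfold liftNear
  exact continuousAt_fst.prodMk ((continuousAt_const.add h1).prodMk
    ((continuousAt_const.add h2).prodMk (by fun_prop)))

/-- Joint continuity in time and initial point of the projections of trajectories. -/
theorem continuous_proj_of_isTraj {h : ℝ} {c : energySurface h → ℝ → Cover}
    (hc : ∀ x, IsTraj h (c x)) (h0 : ∀ x, proj (c x 0) = x) :
    Continuous fun p : ℝ × energySurface h => proj (c p.2 p.1) := by
  obtain ⟨hex, K, hK⟩ := exists_trajectories h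
  rw [continuous_iff_continuousAt]
  rintro ⟨t₀, x₀⟩
  choose! d hd0 hd using hex
  have hmem : ∀ x : energySurface h, proj (liftNear x₀ x) ∈ energySurface h := fun x => by
    rw [proj_liftNear]; exact x.2
  have heq : (fun p : ℝ × energySurface h => proj (c p.2 p.1)) =
      fun p => proj (d (liftNear x₀ p.2) p.1) := by
    funext p
    exact (hc p.2).proj_eq (hd _ (hmem _)) (by rw [h0, hd0 _ (hmem _), proj_liftNear]) p.1
  rw [heq]
  refine ContinuousAt.comp (g := proj) (f := fun p : ℝ × energySurface h => d (liftNear x₀ p.2) p.1)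
    continuous_proj.continuousAt ?_
  have hcont := (hd _ (hmem x₀)).continuous
  rw [ContinuousAt, tendsto_iff_dist_tendsto_zero]
  have hbound : ∀ p : ℝ × energySurface h,
      dist (d (liftNear x₀ p.2) p.1) (d (liftNear x₀ x₀) t₀) ≤
        dist (liftNear x₀ p.2) (liftNear x₀ x₀) * Real.exp (K * |p.1|) +
          dist (d (liftNear x₀ x₀) p.1) (d (liftNear x₀ x₀) t₀) := by
    intro p
    refine (dist_triangle _ (d (liftNear x₀ x₀) p.1) _).trans (add_le_add ?_ le_rfl)
    simpa [hd0 _ (hmem _)] using hK _ _ (hd _ (hmem p.2)) (hd _ (hmem x₀)) p.1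
  have hl : ContinuousAt (fun p : ℝ × energySurface h => liftNear x₀ p.2) (t₀, x₀) :=
    ContinuousAt.comp (g := liftNear x₀) (f := fun p : ℝ × energySurface h => (p.2 : PhaseSpace))
      (continuousAt_liftNear x₀) (by fun_prop)
  have hr : ContinuousAt (fun p : ℝ × energySurface h =>
      dist (liftNear x₀ p.2) (liftNear x₀ x₀) * Real.exp (K * |p.1|) +
          dist (d (liftNear x₀ x₀) p.1) (d (liftNear x₀ x₀) t₀)) (t₀, x₀) := by
    have h1 : Continuous fun p : ℝ × energySurface h => Real.exp (K * |p.1|) := by fun_prop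
    have h2 : Continuous fun p : ℝ × energySurface h => d (liftNear x₀ x₀) p.1 :=
      hcont.comp continuous_fst
    exact ((hl.dist continuousAt_const).mul h1.continuousAt).add
      (h2.continuousAt.dist continuousAt_const)
  have hr' : Filter.Tendsto _ _ _ := hr
  simp only [dist_self, zero_mul, add_zero] at hr'
  exact squeeze_zero (fun _ => dist_nonneg) hbound hr'

theorem IsRegularisedFlow.exists_traj {h : ℝ} {Φ : Flow ℝ (energySurface h)}
    (hΦ : IsRegularisedFlow h Φ) (x : energySurface h) :
    ∃ c, IsTraj h c ∧ ∀ t, proj (c t) = Φ t x := by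
  obtain ⟨c, hc, hd⟩ := hΦ x
  refine ⟨c, ⟨fun t => by rw [hc]; exact (Φ t x).2, fun t => ?_⟩, hc⟩
  rw [← regField_proj, hc]
  exact hd t

theorem existsUnique_flow (h : ℝ) : ∃! Φ : Flow ℝ (energySurface h), IsRegularisedFlow h Φ := by
  have hex : ∀ x : energySurface h, ∃ c, proj (c 0) = x ∧ IsTraj h c := fun x => by
    obtain ⟨c, hc0, hc⟩ := (exists_trajectories h).1 (liftNear x x)
      (by rw [proj_liftNear]; exact x.2)
    exact ⟨c, by rw [hc0, proj_liftNear], hc⟩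
  choose c hc0 hc using hex
  let Φ : Flow ℝ (energySurface h) :=
    { toFun := fun t x => ⟨proj (c x t), (hc x).mem t⟩
      cont' := (continuous_proj_of_isTraj hc hc0).subtype_mk _
      map_add' := fun t₁ t₂ x => Subtype.ext
        (((hc x).comp_add t₂).proj_eq (hc _) (by simp [hc0]) t₁)
      map_zero' := fun x => Subtype.ext (hc0 x) }
  refine ⟨Φ, fun x => ⟨c x, fun _ => rfl, (hc x).deriv⟩, fun Φ' hΦ' => ?_⟩
  ext t x : 2
  obtain ⟨d, hd, hdx⟩ := IsRegularisedFlow.exists_traj hΦ' x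
  change _ = proj (c x t)
  exact (hdx t).symm.trans (hd.proj_eq (hc x) (by rw [hdx, hc0, Φ'.map_zero_apply]) t)

end LogCentralForce

/-! ### The change of variables -/

namespace LogCentralForce

open scoped NNReal Topology
open PhaseSpace

/-- The map `ln r ↦ ln |q| = ln r - 1 / r²`, an increasing homeomorphism of the line. -/
theorem exists_homeomorph_log_radius :
    ∃ e : ℝ ≃ₜ ℝ, ∀ s, e s = s - Real.exp (-2 * s) := by
  have hm : StrictMono fun s : ℝ => s - Real.exp (-2 * s) := by
    intro a b hab
    have : Real.exp (-2 * b) < Real.exp (-2 * a) := Real.exp_lt_exp.2 (by linarith)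
    simp only
    linarith
  have hc : Continuous fun s : ℝ => s - Real.exp (-2 * s) := by fun_prop
  have hs : Function.Surjective fun s : ℝ => s - Real.exp (-2 * s) := by
    refine hc.surjective ?_ ?_
    · refine Filter.tendsto_atTop_mono' _ (f₁ := fun s : ℝ => s - 1) ?_
        (Filter.tendsto_atTop_add_const_right _ _ Filter.tendsto_id)
      filter_upwards [Filter.eventually_ge_atTop 0] with s hs
      have : Real.exp (-2 * s) ≤ 1 := Real.exp_le_one_iff.2 (by linarith)
      linarith
    · refine Filter.tendsto_atBot_mono (fun s => ?_) Filter.tendsto_id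
      simp only [id]
      linarith [Real.exp_pos (-2 * s)]
  exact ⟨(hm.orderIsoOfSurjective _ hs).toHomeomorph, fun s => rfl⟩

/-- The inverse of `ln r ↦ ln r - 1 / r²`. -/
noncomputable def logRadius : ℝ ≃ₜ ℝ := exists_homeomorph_log_radius.choose.symm

theorem logRadius_apply (s : ℝ) : logRadius (s - Real.exp (-2 * s)) = s := by
  rw [← exists_homeomorph_log_radius.choose_spec s]
  exact exists_homeomorph_log_radius.choose.symm_apply_apply s

theorem logRadius_sub (u : ℝ) : logRadius u - Real.exp (-2 * logRadius u) = u := by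
  rw [← exists_homeomorph_log_radius.choose_spec]
  exact exists_homeomorph_log_radius.choose.apply_symm_apply u

/-- The polar angle of a vector of the plane, `0` for the zero vector. -/
noncomputable def polarAngle (q : Plane) : Real.Angle := (Complex.arg ⟨q 0, q 1⟩ : ℝ)

theorem norm_complex_mk (q : Plane) : ‖(⟨q 0, q 1⟩ : ℂ)‖ = ‖q‖ := by
  rw [Complex.norm_def, Complex.normSq_mk, EuclideanSpace.norm_eq, Fin.sum_univ_two]
  simp [sq]

theorem complex_mk_ne_zero {q : Plane} (hq : q ≠ 0) : (⟨q 0, q 1⟩ : ℂ) ≠ 0 := by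
  rw [← norm_ne_zero_iff, norm_complex_mk]
  exact norm_ne_zero_iff.2 hq

theorem continuousAt_polarAngle {q : Plane} (hq : q ≠ 0) : ContinuousAt polarAngle q := by
  have h1 : Continuous fun q : Plane => (⟨q 0, q 1⟩ : ℂ) := by
    have : (fun q : Plane => (⟨q 0, q 1⟩ : ℂ)) = fun q => (q 0 : ℂ) + (q 1 : ℂ) * Complex.I := by
      funext q; exact Complex.mk_eq_add_mul_I _ _
    rw [this]
    fun_prop
  exact ContinuousAt.comp (g := fun z : ℂ => (Complex.arg z : Real.Angle))
    (Complex.continuousAt_arg_coe_angle (complex_mk_ne_zero hq)) h1.continuousAt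

theorem norm_smul_polarAngle {q : Plane} (hq : q ≠ 0) :
    ‖q‖ • (!₂[(polarAngle q).cos, (polarAngle q).sin] : Plane) = q := by
  have hq' := norm_ne_zero_iff.2 hq
  ext i
  fin_cases i
  · simp [polarAngle, Complex.cos_arg (complex_mk_ne_zero hq), norm_complex_mk]
    field_simp
  · simp [polarAngle, Complex.sin_arg, norm_complex_mk]
    field_simp

theorem polarAngle_smul {ρ : ℝ} (hρ : 0 < ρ) (θ : Real.Angle) :
    polarAngle (ρ • (!₂[θ.cos, θ.sin] : Plane)) = θ := by
  have h := Complex.arg_mul_cos_add_sin_mul_I_coe_angle hρ θ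
  unfold polarAngle
  convert h using 3
  apply Complex.ext <;> simp

theorem norm_smul_unit {ρ : ℝ} (hρ : 0 < ρ) (θ : Real.Angle) :
    ‖(ρ • (!₂[θ.cos, θ.sin] : Plane))‖ = ρ := by
  rw [norm_smul, EuclideanSpace.norm_eq, Fin.sum_univ_two]
  simp [abs_of_pos hρ]

/-- The inverse of `blowDown`. -/
noncomputable def blowUp (z : Plane × Plane) : PhaseSpace :=
  (Real.exp (logRadius (Real.log ‖z.1‖)), polarAngle z.1 - polarAngle z.2, polarAngle z.2,
    logRadius (Real.log ‖z.1‖) + Real.log ‖z.2‖)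

theorem exp_neg_two_mul_log {s : ℝ} (hs : 0 < s) : Real.exp (-2 * Real.log s) = 1 / s ^ 2 := by
  rw [neg_mul, Real.exp_neg, mul_comm, Real.exp_mul, Real.exp_log hs]
  norm_num

theorem radius_pos {x : PhaseSpace} (hx : 0 < r x) : 0 < r x * Real.exp (-1 / r x ^ 2) := by
  positivity

theorem norm_blowDown_fst {x : PhaseSpace} (hx : 0 < r x) :
    ‖(blowDown x).1‖ = r x * Real.exp (-1 / r x ^ 2) :=
  norm_smul_unit (radius_pos hx) (φ x + ψ x)

theorem norm_blowDown_snd {x : PhaseSpace} (hx : 0 < r x) :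
    ‖(blowDown x).2‖ = Real.exp (w x) / r x :=
  norm_smul_unit (by positivity) (ψ x)

theorem log_norm_blowDown_fst {x : PhaseSpace} (hx : 0 < r x) :
    Real.log ‖(blowDown x).1‖ = Real.log (r x) - 1 / r x ^ 2 := by
  rw [norm_blowDown_fst hx, Real.log_mul hx.ne' (Real.exp_pos _).ne', Real.log_exp]
  ring

theorem blowUp_blowDown {x : PhaseSpace} (hx : 0 < r x) : blowUp (blowDown x) = x := by
  have h1 : logRadius (Real.log ‖(blowDown x).1‖) = Real.log (r x) := by
    rw [log_norm_blowDown_fst hx, ← exp_neg_two_mul_log hx, logRadius_apply]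
  have h2 : polarAngle (blowDown x).1 = φ x + ψ x := polarAngle_smul (radius_pos hx) _
  have h3 : polarAngle (blowDown x).2 = ψ x := polarAngle_smul (by positivity) _
  unfold blowUp
  rw [h1, h2, h3, norm_blowDown_snd hx, Real.log_div (Real.exp_pos _).ne' hx.ne', Real.log_exp,
    Real.exp_log hx]
  ext <;> simp [r, φ, ψ, w]

theorem blowDown_blowUp {z : Plane × Plane} (hq : z.1 ≠ 0) (hp : z.2 ≠ 0) :
    blowDown (blowUp z) = z := by
  have hq' := norm_pos_iff.2 hq
  have hp' := norm_pos_iff.2 hp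
  set s := logRadius (Real.log ‖z.1‖) with hs
  have h1 : Real.exp s * Real.exp (-1 / Real.exp s ^ 2) = ‖z.1‖ := by
    rw [← Real.exp_add, ← Real.exp_log hq', ← logRadius_sub (Real.log ‖z.1‖), ← hs,
      ← Real.exp_nat_mul, neg_div, one_div, ← Real.exp_neg]
    push_cast
    ring_nf
  have h2 : Real.exp (s + Real.log ‖z.2‖) / Real.exp s = ‖z.2‖ := by
    rw [Real.exp_add, Real.exp_log hp']
    field_simp
  unfold blowDown blowUp
  simp only [r, φ, ψ, w, ← hs, h1, h2, sub_add_cancel]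
  exact Prod.ext (norm_smul_polarAngle hq) (norm_smul_polarAngle hp)

theorem hamiltonian_blowDown {h : ℝ} {x : PhaseSpace} (hx : 0 < r x) :
    hamiltonian (blowDown x) = h ↔ x ∈ energySurface h := by
  rw [mem_energySurface_iff, hamiltonian, log_norm_blowDown_fst hx, norm_blowDown_snd hx, div_pow,
    ← Real.exp_nat_mul, kinetic]
  push_cast
  constructor
  · intro hh
    refine ⟨hx.le, ?_⟩
    rw [← hh]
    field_simp
    ring
  · rintro ⟨-, hh⟩
    rw [hh]
    field_simp
    ring

theorem continuousAt_blowDown {x : PhaseSpace} (hx : 0 < r x) : ContinuousAt blowDown x := by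
  have hr : ContinuousAt (fun x : PhaseSpace => -1 / r x ^ 2) x := by
    have : r x ^ 2 ≠ 0 := by positivity
    unfold r at this ⊢
    fun_prop (disch := assumption)
  have hr' : ContinuousAt (fun x : PhaseSpace => Real.exp (w x) / r x) x := by
    have := hx.ne'
    unfold r w at *
    fun_prop (disch := assumption)
  have hv : Continuous fun θ : Real.Angle => (!₂[θ.cos, θ.sin] : Plane) := by
    have := Real.Angle.continuous_cos
    have := Real.Angle.continuous_sin
    fun_prop
  have h1 : Continuous fun x : PhaseSpace => φ x + ψ x := by unfold φ ψ; fun_prop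
  have h2 : Continuous fun x : PhaseSpace => ψ x := by unfold ψ; fun_prop
  have h3 : Continuous fun x : PhaseSpace => r x := by unfold r; fun_prop
  exact ((h3.continuousAt.mul hr.rexp).smul (hv.comp h1).continuousAt).prodMk
    (hr'.smul (hv.comp h2).continuousAt)

theorem continuousAt_blowUp {z : Plane × Plane} (hq : z.1 ≠ 0) (hp : z.2 ≠ 0) :
    ContinuousAt blowUp z := by
  have h1 : ContinuousAt (fun z : Plane × Plane => polarAngle z.1) z :=
    (continuousAt_polarAngle hq).comp continuousAt_fst
  have h2 : ContinuousAt (fun z : Plane × Plane => polarAngle z.2) z :=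
    (continuousAt_polarAngle hp).comp continuousAt_snd
  have h3 : ContinuousAt (fun z : Plane × Plane => Real.log ‖z.1‖) z :=
    continuousAt_fst.norm.log (norm_ne_zero_iff.2 hq)
  have h4 : ContinuousAt (fun z : Plane × Plane => Real.log ‖z.2‖) z :=
    continuousAt_snd.norm.log (norm_ne_zero_iff.2 hp)
  have h5 : ContinuousAt (fun z : Plane × Plane => logRadius (Real.log ‖z.1‖)) z :=
    logRadius.continuous.continuousAt.comp h3
  exact h5.rexp.prodMk ((h1.sub h2).prodMk (h2.prodMk (h5.add h4)))

theorem exists_homeomorph_blowDown (h : ℝ) :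
    ∃ T : {x : energySurface h // 0 < r (x : PhaseSpace)} ≃ₜ
      {z : Plane × Plane // z.1 ≠ 0 ∧ z.2 ≠ 0 ∧ hamiltonian z = h},
    ∀ x, (T x : Plane × Plane) = blowDown x := by
  have hpos : ∀ z, 0 < r (blowUp z) := fun z => Real.exp_pos _
  refine ⟨⟨⟨fun x => ⟨blowDown x, ?_, ?_, (hamiltonian_blowDown x.2).2 x.1.2⟩,
    fun z => ⟨⟨blowUp z, ?_⟩, hpos z⟩, fun x => ?_, fun z => ?_⟩, ?_, ?_⟩, fun x => rfl⟩
  · rw [← norm_pos_iff, norm_blowDown_fst x.2]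
    exact radius_pos x.2
  · rw [← norm_pos_iff, norm_blowDown_snd x.2]
    have := x.2
    positivity
  · rw [← hamiltonian_blowDown (hpos z), blowDown_blowUp z.2.1 z.2.2.1]
    exact z.2.2.2
  · exact Subtype.ext (Subtype.ext (blowUp_blowDown x.2))
  · exact Subtype.ext (blowDown_blowUp z.2.1 z.2.2.1)
  · refine Continuous.subtype_mk (continuous_iff_continuousAt.2 fun x => ?_) _
    exact ContinuousAt.comp (g := blowDown) (continuousAt_blowDown x.2)
      (continuous_subtype_val.comp continuous_subtype_val).continuousAt
  · refine Continuous.subtype_mk (Continuous.subtype_mk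
      (continuous_iff_continuousAt.2 fun z => ?_) _) _
    exact (continuousAt_blowUp z.2.1 z.2.2.1).comp continuous_subtype_val.continuousAt

/-- `r` vanishes identically along a trajectory or never. -/
theorem IsTraj.exists_radius_factor {h : ℝ} {c : ℝ → Cover} (hc : IsTraj h c) :
    ∃ m : ℝ → ℝ, (∀ t, 0 < m t) ∧ ∀ t, (c t).1 = (c 0).1 * m t := by
  have hcc := hc.continuous
  have hne : ∀ t, (c t).1 ^ 2 + 2 ≠ 0 := fun t => by positivity
  refine exists_pos_factor (u := fun t => (c t).1)
    (k := fun t => -((c t).1 ^ 2 / ((c t).1 ^ 2 + 2) * Real.exp (2 * (c t).2.2.2)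
      * Real.cos (c t).2.1)) (by fun_prop (disch := exact hne)) (fun t => ?_)
  refine (hasDerivAt_cover.1 (hc.deriv t)).1.congr_deriv ?_
  have := hne t
  simp only [coverField]
  field_simp

theorem IsTraj.radius_pos {h : ℝ} {c : ℝ → Cover} (hc : IsTraj h c) (h0 : 0 < (c 0).1) (t : ℝ) :
    0 < (c t).1 := by
  obtain ⟨m, hm, hr⟩ := hc.exists_radius_factor
  rw [hr]
  exact mul_pos h0 (hm t)

/-- Off `r = 0`, the change of variables and the change of time carry the regularised equations to
the logarithm problem. -/
theorem IsTraj.hasDerivAt_blowDown {h : ℝ} {c : ℝ → Cover} (hc : IsTraj h c) {t : ℝ}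
    (hr : 0 < (c t).1) :
    HasDerivAt (fun s => blowDown (proj (c s)))
      (timeFactor (proj (c t)) • logField (blowDown (proj (c t)))) t := by
  obtain ⟨h1, h2, h3, h4⟩ := hasDerivAt_cover.1 (hc.deriv t)
  simp only [coverField] at h1 h2 h3 h4
  have hr0 := hr.ne'
  have hrx : 0 < r (proj (c t)) := hr
  have hw : Real.exp (2 * (c t).2.2.2) = Real.exp (c t).2.2.2 ^ 2 := by
    rw [← Real.exp_nat_mul]; norm_num
  have hexp : Real.exp ((c t).2.2.2 - 1 / (c t).1 ^ 2) =
      Real.exp (c t).2.2.2 * Real.exp (-1 / (c t).1 ^ 2) := by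
    rw [← Real.exp_add]; ring_nf
  have hne : (c t).1 ^ 2 + 2 ≠ 0 := by positivity
  have hρ : HasDerivAt (fun s => (c s).1 * Real.exp (-1 / (c s).1 ^ 2))
      (-((c t).1 * Real.exp (-1 / (c t).1 ^ 2) * Real.exp (c t).2.2.2 ^ 2
        * Real.cos (c t).2.1)) t := by
    refine (h1.mul ((((hasDerivAt_const t (-1 : ℝ)).div (h1.pow 2)
      (pow_ne_zero 2 hr0))).exp)).congr_deriv ?_
    rw [hw]
    simp only [Pi.div_apply, Pi.pow_apply]
    field_simp
    ring
  have hσ : HasDerivAt (fun s => Real.exp (c s).2.2.2 / (c s).1)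
      (Real.exp (c t).2.2.2 * (c t).1 * Real.cos (c t).2.1) t := by
    refine (h4.exp.div h1 hr0).congr_deriv ?_
    rw [hw]
    field_simp
    ring
  have hq0 := hρ.mul (h2.add h3).cos
  have hq1 := hρ.mul (h2.add h3).sin
  have hp0 := hσ.mul h3.cos
  have hp1 := hσ.mul h3.sin
  have hvec : ∀ {f g : ℝ → ℝ} {f' g' : ℝ}, HasDerivAt f f' t → HasDerivAt g g' t →
      HasDerivAt (fun s => (!₂[f s, g s] : Plane)) !₂[f', g'] t := by
    intro f g f' g' hf hg
    have : HasDerivAt (fun s => ![f s, g s]) ![f', g'] t := by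
      rw [hasDerivAt_pi]
      intro i
      fin_cases i
      · exact hf
      · exact hg
    exact (PiLp.hasFDerivAt_toLp 2 _).comp_hasDerivAt t this
  have hB : (fun s => blowDown (proj (c s))) = fun s =>
      ((!₂[(c s).1 * Real.exp (-1 / (c s).1 ^ 2) * Real.cos ((c s).2.1 + (c s).2.2.1),
        (c s).1 * Real.exp (-1 / (c s).1 ^ 2) * Real.sin ((c s).2.1 + (c s).2.2.1)],
      !₂[Real.exp (c s).2.2.2 / (c s).1 * Real.cos (c s).2.2.1,
        Real.exp (c s).2.2.2 / (c s).1 * Real.sin (c s).2.2.1]) : Plane × Plane) := by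
    funext s
    refine Prod.ext ?_ ?_ <;> ext i <;> fin_cases i <;>
      simp [blowDown, proj, r, φ, ψ, w, ← Real.Angle.coe_add]
  rw [hB]
  refine ((hvec hq0 hq1).prodMk (hvec hp0 hp1)).congr_deriv ?_
  rw [logField, norm_blowDown_fst hrx]
  have hcs := Real.sin_sq_add_cos_sq (c t).2.1
  have hexp' := (Real.exp_pos (-1 / (c t).1 ^ 2)).ne'
  -- With `θ = φ + ψ`, the relations `cos φ cos θ + sin φ sin θ = cos ψ` and its companion.
  refine Prod.ext ?_ ?_ <;> ext i <;> fin_cases i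
  all_goals simp [blowDown, timeFactor, proj, r, φ, ψ, w, ← Real.Angle.coe_add]
  all_goals simp only [hexp, hw, ← one_div, Real.cos_add, Real.sin_add]
  all_goals generalize Real.exp (-1 / (c t).1 ^ 2) = A at hexp' ⊢
  all_goals generalize (c t).1 = ρ at hr0 ⊢
  all_goals generalize Real.exp (c t).2.2.2 = v
  all_goals generalize Real.cos (c t).2.1 = C at hcs ⊢
  all_goals generalize Real.sin (c t).2.1 = S at hcs ⊢
  all_goals field_simp
  · linear_combination (-v ^ 2 * Real.cos (c t).2.2.1) * hcs
  · linear_combination (-v ^ 2 * Real.sin (c t).2.2.1) * hcs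
  · ring
  · ring

theorem isBlowUpOfLogProblem {h : ℝ} {Φ : Flow ℝ (energySurface h)}
    (hΦ : IsRegularisedFlow h Φ) : IsBlowUpOfLogProblem h Φ := by
  refine ⟨exists_homeomorph_blowDown h, fun x hx τ => ?_⟩
  obtain ⟨c, hc, hcΦ⟩ := hΦ.exists_traj x
  have h0 : 0 < (c 0).1 := by
    have : proj (c 0) = x := by rw [hcΦ, Φ.map_zero_apply]
    rw [← this] at hx
    exact hx
  simp only [← hcΦ]
  exact ⟨hc.radius_pos h0 τ, hc.hasDerivAt_blowDown (hc.radius_pos h0 τ)⟩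

end LogCentralForce

/-! ### Symmetries and conserved quantities -/

namespace LogCentralForce

open scoped NNReal Topology
open PhaseSpace

variable {h : ℝ} {c : ℝ → Cover}

theorem IsTraj.radius_nonneg (hc : IsTraj h c) (t : ℝ) : 0 ≤ (c t).1 :=
  (mem_energySurface_iff.1 (hc.mem t)).1

theorem IsTraj.exp_eq (hc : IsTraj h c) (t : ℝ) : Real.exp (2 * (c t).2.2.2) = kinetic h (c t).1 :=
  (mem_energySurface_iff.1 (hc.mem t)).2

/-- The equations are reversible: `(r, φ, ψ, w) ↦ (r, π - φ, -ψ, w)` reverses time. -/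
theorem IsTraj.reverse (hc : IsTraj h c) :
    IsTraj h fun t => ((c (-t)).1, Real.pi - (c (-t)).2.1, -(c (-t)).2.2.1, (c (-t)).2.2.2) := by
  refine ⟨fun t => hc.mem (-t), fun t => ?_⟩
  have hd : HasDerivAt (fun s => c (-s)) (-coverField (c (-t))) t := by
    simpa [Function.comp_def] using (hc.deriv (-t)).scomp t (hasDerivAt_neg t)
  obtain ⟨h1, h2, h3, h4⟩ := hasDerivAt_cover.1 hd
  refine hasDerivAt_cover.2 ⟨h1.congr_deriv ?_, (h2.const_sub _).congr_deriv ?_,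
    h3.neg.congr_deriv ?_, h4.congr_deriv ?_⟩ <;>
  simp [coverField]

/-- The reflection `(r, φ, ψ, w) ↦ (r, -φ, -ψ, w)` is a symmetry of the equations. -/
theorem IsTraj.reflect (hc : IsTraj h c) :
    IsTraj h fun t => ((c t).1, -(c t).2.1, -(c t).2.2.1, (c t).2.2.2) := by
  refine ⟨fun t => hc.mem t, fun t => ?_⟩
  obtain ⟨h1, h2, h3, h4⟩ := hasDerivAt_cover.1 (hc.deriv t)
  refine hasDerivAt_cover.2 ⟨h1.congr_deriv ?_, h2.neg.congr_deriv ?_,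
    h3.neg.congr_deriv ?_, h4.congr_deriv ?_⟩ <;>
  simp [coverField]

theorem IsTraj.hasDerivAt_radius (hc : IsTraj h c) (t : ℝ) :
    HasDerivAt (fun s => (c s).1)
      (-((c t).1 ^ 3 / ((c t).1 ^ 2 + 2)) * Real.exp (2 * (c t).2.2.2) * Real.cos (c t).2.1) t :=
  (hasDerivAt_cover.1 (hc.deriv t)).1

theorem IsTraj.hasDerivAt_phi (hc : IsTraj h c) (t : ℝ) :
    HasDerivAt (fun s => (c s).2.1) ((kinetic h (c t).1 - (c t).1 ^ 2) * Real.sin (c t).2.1) t := by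
  rw [← hc.exp_eq]
  exact (hasDerivAt_cover.1 (hc.deriv t)).2.1

theorem IsTraj.hasDerivAt_psi (hc : IsTraj h c) (t : ℝ) :
    HasDerivAt (fun s => (c s).2.2.1) ((c t).1 ^ 2 * Real.sin (c t).2.1) t :=
  (hasDerivAt_cover.1 (hc.deriv t)).2.2.1

theorem IsTraj.exists_sin_factor (hc : IsTraj h c) :
    ∃ m : ℝ → ℝ, (∀ t, 0 < m t) ∧ ∀ t, Real.sin (c t).2.1 = Real.sin (c 0).2.1 * m t := by
  have hcc := hc.continuous
  have hk := continuous_kinetic h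
  refine exists_pos_factor (u := fun t => Real.sin (c t).2.1)
    (k := fun t => Real.cos (c t).2.1 * (kinetic h (c t).1 - (c t).1 ^ 2)) (by fun_prop)
    (fun t => (hc.hasDerivAt_phi t).sin.congr_deriv (by ring))

/-- If `φ` starts at a zero of the sine, it is constant. -/
theorem IsTraj.phi_const (hc : IsTraj h c) (h0 : Real.sin (c 0).2.1 = 0) (t : ℝ) :
    (c t).2.1 = (c 0).2.1 := by
  obtain ⟨m, -, hm⟩ := hc.exists_sin_factor
  exact is_const_of_deriv_eq_zero (fun t => (hc.hasDerivAt_phi t).differentiableAt)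
    (fun t => (hc.hasDerivAt_phi t).deriv.trans (by rw [hm, h0, zero_mul, mul_zero])) t 0

theorem IsTraj.sin_pos (hc : IsTraj h c) (h0 : (c 0).2.1 ∈ Set.Ioo 0 Real.pi) (t : ℝ) :
    0 < Real.sin (c t).2.1 := by
  obtain ⟨m, hm, hs⟩ := hc.exists_sin_factor
  rw [hs]
  exact mul_pos (Real.sin_pos_of_mem_Ioo h0) (hm t)

/-- The half circle `0 < φ < π` is invariant. -/
theorem IsTraj.phi_mem (hc : IsTraj h c) (h0 : (c 0).2.1 ∈ Set.Ioo 0 Real.pi) (t : ℝ) :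
    (c t).2.1 ∈ Set.Ioo 0 Real.pi := by
  have hcc := hc.continuous
  have hcont : Continuous fun t => (c t).2.1 := by fun_prop
  have hne : ∀ b : ℝ, Real.sin b = 0 → b ∉ Set.range fun t => (c t).2.1 := by
    rintro b hb ⟨s, rfl⟩
    exact (hc.sin_pos h0 s).ne' hb
  have hconn := (isPreconnected_range hcont).ordConnected
  constructor
  · by_contra! hle
    exact hne 0 Real.sin_zero (hconn.out ⟨t, rfl⟩ ⟨0, rfl⟩ ⟨hle, h0.1.le⟩)
  · by_contra! hle
    exact hne Real.pi Real.sin_pi (hconn.out ⟨0, rfl⟩ ⟨t, rfl⟩ ⟨h0.2.le, hle⟩)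

/-- The function `κ(r) = e^{2w - 2/r²}` on the energy level, with `κ(0) = 0`; the square of the
angular momentum is `κ(r) sin² φ`. -/
noncomputable def kappa (h s : ℝ) : ℝ := kinetic h s * expNegInvGlue (s ^ 2 / 2)

theorem continuous_kappa (h : ℝ) : Continuous (kappa h) := by
  have h1 := continuous_kinetic h
  have h2 : Continuous expNegInvGlue := (expNegInvGlue.contDiff (n := 0)).continuous
  unfold kappa
  fun_prop

theorem kappa_zero (h : ℝ) : kappa h 0 = 0 := by
  simp [kappa, expNegInvGlue]

theorem expNegInvGlue_sq {s : ℝ} (hs : 0 < s) :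
    expNegInvGlue (s ^ 2 / 2) = Real.exp (-2 / s ^ 2) := by
  rw [expNegInvGlue, if_neg (not_le.2 (by positivity)), inv_div, neg_div]

theorem hasDerivAt_exp_neg_two_div_sq {s : ℝ} (hs : s ≠ 0) :
    HasDerivAt (fun s : ℝ => Real.exp (-2 / s ^ 2)) (Real.exp (-2 / s ^ 2) * (4 / s ^ 3)) s := by
  refine (((hasDerivAt_const s (-2 : ℝ)).div (hasDerivAt_pow 2 s)
    (pow_ne_zero 2 hs)).exp).congr_deriv ?_
  simp only [Pi.div_apply]
  field_simp
  push_cast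
  ring

theorem hasDerivAt_kappa (h : ℝ) {s : ℝ} (hs : 0 < s) :
    HasDerivAt (kappa h)
      (Real.exp (-2 / s ^ 2) * (2 * (s ^ 2 + 2) / s ^ 3) * (kinetic h s - s ^ 2)) s := by
  have h1 : HasDerivAt (fun s => kinetic h s * Real.exp (-2 / s ^ 2)) _ s :=
    (hasDerivAt_kinetic h hs).mul (hasDerivAt_exp_neg_two_div_sq hs.ne')
  refine (h1.congr_deriv ?_).congr_of_eventuallyEq ?_
  · field_simp
    ring
  · filter_upwards [lt_mem_nhds hs] with u hu
    rw [kappa, expNegInvGlue_sq hu]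

/-- Conservation of the square of the angular momentum. -/
theorem IsTraj.kappa_mul_sin_sq (hc : IsTraj h c) (h0 : 0 < (c 0).1) (t : ℝ) :
    kappa h (c t).1 * Real.sin (c t).2.1 ^ 2 = kappa h (c 0).1 * Real.sin (c 0).2.1 ^ 2 := by
  have hd : ∀ t, HasDerivAt (fun t => kappa h (c t).1 * Real.sin (c t).2.1 ^ 2) 0 t := by
    intro t
    have hr := hc.radius_pos h0 t
    have h1 := ((hasDerivAt_kappa h hr).comp t (hc.hasDerivAt_radius t)).mul
      ((hc.hasDerivAt_phi t).sin.pow 2)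
    refine HasDerivAt.congr_deriv (f := fun t => kappa h (c t).1 * Real.sin (c t).2.1 ^ 2) h1 ?_
    simp only [Pi.pow_apply, Function.comp_apply, kappa, expNegInvGlue_sq hr, hc.exp_eq]
    have : (c t).1 ^ 2 + 2 ≠ 0 := by positivity
    field_simp
    push_cast
    ring
  exact is_const_of_deriv_eq_zero (fun t => (hd t).differentiableAt) (fun t => (hd t).deriv) t 0

/-! ### Small radii -/

/-- The radius `δ` is admissible if `e^{2w} ≥ 1 + r²` on the part `r ≤ δ` of the energy level. -/
structure IsSmall (h δ : ℝ) : Prop where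
  pos : 0 < δ
  le : ∀ s ∈ Set.Icc 0 δ, s ^ 2 + 1 ≤ kinetic h s

/-- Small radii are admissible, since `e^{2w} = 2` at `r = 0`. -/
theorem exists_isSmall (h : ℝ) : ∃ δ₀ : ℝ, 0 < δ₀ ∧ ∀ δ, 0 < δ → δ ≤ δ₀ → IsSmall h δ := by
  have hk := continuous_kinetic h
  have hcont : Continuous fun s => kinetic h s - s ^ 2 := by fun_prop
  have h0 : (1 : ℝ) < kinetic h 0 - 0 ^ 2 := by rw [kinetic_zero]; norm_num
  obtain ⟨ε, hε, hball⟩ := Metric.eventually_nhds_iff.1 (hcont.continuousAt.eventually_const_lt h0)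
  refine ⟨ε / 2, by positivity, fun δ hδ hle => ⟨hδ, fun s hs => ?_⟩⟩
  have := hball (y := s) (by rw [Real.dist_0_eq_abs, abs_of_nonneg hs.1]; linarith [hs.2])
  linarith

theorem IsSmall.strictMonoOn_kappa {δ : ℝ} (hδ : IsSmall h δ) :
    StrictMonoOn (kappa h) (Set.Icc 0 δ) := by
  refine strictMonoOn_of_deriv_pos (convex_Icc _ _) (continuous_kappa h).continuousOn ?_
  intro s hs
  rw [interior_Icc] at hs
  rw [(hasDerivAt_kappa h hs.1).deriv]
  have h1 := hδ.le s (Set.Ioo_subset_Icc_self hs)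
  have h2 : 0 < kinetic h s - s ^ 2 := by linarith
  have h3 := hs.1
  positivity

theorem IsSmall.kappa_pos {δ s : ℝ} (hδ : IsSmall h δ) (hs : s ∈ Set.Ioc 0 δ) : 0 < kappa h s := by
  rw [← kappa_zero h]
  exact hδ.strictMonoOn_kappa ⟨le_rfl, hδ.pos.le⟩ (Set.Ioc_subset_Icc_self hs) hs.1

/-- An orbit of the half circle `0 < φ < π` leaves the block: inside it, conservation of the angular
momentum bounds `sin φ`, hence `φ'`, away from zero. -/
theorem IsTraj.exists_exit {δ : ℝ} (hc : IsTraj h c) (hδ : IsSmall h δ)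
    (hr : (c 0).1 ∈ Set.Ioc 0 δ) (h0 : (c 0).2.1 ∈ Set.Ioo 0 Real.pi) :
    ∃ t, 0 < t ∧ δ < (c t).1 := by
  by_contra! hle
  have hle' : ∀ t, 0 ≤ t → (c t).1 ≤ δ := fun t ht =>
    ht.eq_or_lt.elim (fun h => h ▸ hr.2) (hle t)
  have hκδ := hδ.kappa_pos ⟨hδ.pos, le_rfl⟩
  set L := kappa h (c 0).1 * Real.sin (c 0).2.1 ^ 2 with hL
  have hLpos : 0 < L := mul_pos (hδ.kappa_pos hr) (pow_pos (hc.sin_pos h0 0) 2)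
  set η := L / kappa h δ with hη
  have hηpos : 0 < η := div_pos hLpos hκδ
  have hphi : ∀ t, 0 ≤ t → η ≤ (kinetic h (c t).1 - (c t).1 ^ 2) * Real.sin (c t).2.1 := by
    intro t ht
    have hrt : (c t).1 ∈ Set.Icc 0 δ := ⟨hc.radius_nonneg t, hle' t ht⟩
    have h1 : kappa h (c t).1 ≤ kappa h δ :=
      hδ.strictMonoOn_kappa.monotoneOn hrt ⟨hδ.pos.le, le_rfl⟩ hrt.2
    have h2 : L ≤ kappa h δ * Real.sin (c t).2.1 ^ 2 := by
      rw [hL, ← hc.kappa_mul_sin_sq hr.1 t]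
      exact mul_le_mul_of_nonneg_right h1 (sq_nonneg _)
    have h3 : η ≤ Real.sin (c t).2.1 ^ 2 := by
      rw [hη, div_le_iff₀ hκδ]
      linarith
    have h4 := hc.sin_pos h0 t
    have h5 := Real.sin_le_one (c t).2.1
    have h6 := hδ.le _ hrt
    nlinarith
  have hmono : MonotoneOn (fun t => (c t).2.1 - η * t) (Set.Ici 0) := by
    have hd : ∀ t, HasDerivAt (fun t => (c t).2.1 - η * t) _ t := fun t =>
      (hc.hasDerivAt_phi t).sub ((hasDerivAt_id t).const_mul η)
    refine monotoneOn_of_deriv_nonneg (convex_Ici 0)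
      (fun t _ => (hd t).continuousAt.continuousWithinAt)
      (fun t _ => (hd t).differentiableAt.differentiableWithinAt) (fun t ht => ?_)
    rw [interior_Ici] at ht
    rw [(hd t).deriv]
    linarith [hphi t (le_of_lt ht)]
  have hT : 0 ≤ Real.pi / η := by positivity
  have := hmono Set.self_mem_Ici hT hT
  simp only [mul_zero, sub_zero, mul_div_cancel₀ _ hηpos.ne'] at this
  linarith [(hc.phi_mem h0 (Real.pi / η)).2, h0.1]

end LogCentralForce

/-! ### Crossing the boundary of the block -/

namespace LogCentralForce

open scoped NNReal Topology
open PhaseSpace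

variable {h δ : ℝ} {c : ℝ → Cover}

theorem IsTraj.radius_strictMonoOn (hc : IsTraj h c) (h0 : 0 < (c 0).1) {a b : ℝ}
    (hcos : ∀ t ∈ Set.Ioo a b, Real.cos (c t).2.1 < 0) :
    StrictMonoOn (fun t => (c t).1) (Set.Icc a b) := by
  refine strictMonoOn_of_deriv_pos (convex_Icc _ _)
    (fun t _ => (hc.hasDerivAt_radius t).continuousAt.continuousWithinAt) (fun t ht => ?_)
  rw [interior_Icc] at ht
  rw [(hc.hasDerivAt_radius t).deriv]
  have h1 := hcos t ht
  have h2 := hc.radius_pos h0 t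
  have h3 : 0 < (c t).1 ^ 3 / ((c t).1 ^ 2 + 2) * Real.exp (2 * (c t).2.2.2) := by positivity
  nlinarith

theorem IsTraj.radius_strictAntiOn (hc : IsTraj h c) (h0 : 0 < (c 0).1) {a b : ℝ}
    (hcos : ∀ t ∈ Set.Ioo a b, 0 < Real.cos (c t).2.1) :
    StrictAntiOn (fun t => (c t).1) (Set.Icc a b) := by
  refine strictAntiOn_of_deriv_neg (convex_Icc _ _)
    (fun t _ => (hc.hasDerivAt_radius t).continuousAt.continuousWithinAt) (fun t ht => ?_)
  rw [interior_Icc] at ht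
  rw [(hc.hasDerivAt_radius t).deriv]
  have h1 := hcos t ht
  have h2 := hc.radius_pos h0 t
  have h3 : 0 < (c t).1 ^ 3 / ((c t).1 ^ 2 + 2) * Real.exp (2 * (c t).2.2.2) := by positivity
  nlinarith

theorem IsTraj.continuous_phi (hc : IsTraj h c) : Continuous fun t => (c t).2.1 := by
  have := hc.continuous
  fun_prop

theorem IsTraj.continuous_radius (hc : IsTraj h c) : Continuous fun t => (c t).1 := by
  have := hc.continuous
  fun_prop

/-- At a boundary point with `cos φ ≤ 0` the orbit leaves the block at once. In the tangency case
`cos φ = 0` this is because `cos φ` then has negative derivative. -/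
theorem IsTraj.exists_exits (hc : IsTraj h c) (hδ : IsSmall h δ) (h0 : (c 0).1 = δ)
    (hcos : Real.cos (c 0).2.1 ≤ 0) : ∃ ε > 0, ∀ t ∈ Set.Ioo 0 ε, δ < (c t).1 := by
  have hr0 : 0 < (c 0).1 := h0 ▸ hδ.pos
  have hev : ∀ᶠ t in 𝓝[>] (0 : ℝ), Real.cos (c t).2.1 < 0 := by
    rcases hcos.lt_or_eq with hlt | heq
    · exact nhdsWithin_le_nhds
        ((Real.continuous_cos.comp hc.continuous_phi).continuousAt.eventually_lt_const hlt)
    · have hd := (hc.hasDerivAt_phi 0).cos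
      have hneg : -Real.sin (c 0).2.1 *
          ((kinetic h (c 0).1 - (c 0).1 ^ 2) * Real.sin (c 0).2.1) < 0 := by
        have h1 := Real.sin_sq_add_cos_sq (c 0).2.1
        rw [heq] at h1
        have h2 := hδ.le (c 0).1 ⟨hr0.le, h0.le⟩
        nlinarith
      have := (hasDerivAt_iff_tendsto_slope.1 hd).eventually_lt_const hneg
      filter_upwards [nhdsWithin_mono _ (fun t (ht : t ∈ Set.Ioi (0 : ℝ)) => ne_of_gt ht) this,
        self_mem_nhdsWithin] with t ht htpos
      have htpos' : (0 : ℝ) < t := htpos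
      rw [slope_def_field, heq, sub_zero, sub_zero, div_lt_iff₀ htpos', zero_mul] at ht
      exact ht
  obtain ⟨ε, hε, hsub⟩ := mem_nhdsGT_iff_exists_Ioo_subset.1 hev
  have hε' : (0 : ℝ) < ε := hε
  refine ⟨ε, hε', fun t ht => ?_⟩
  have := hc.radius_strictMonoOn hr0 (a := 0) (b := ε) (fun t ht => hsub ht)
    ⟨le_rfl, hε'.le⟩ ⟨ht.1.le, ht.2.le⟩ ht.1
  simpa [h0] using this

theorem IsTraj.exists_enters (hc : IsTraj h c) (hδ : 0 < δ) (h0 : (c 0).1 = δ)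
    (hcos : 0 < Real.cos (c 0).2.1) : ∃ ε > 0, ∀ t ∈ Set.Ioo 0 ε, (c t).1 < δ := by
  have hr0 : 0 < (c 0).1 := h0 ▸ hδ
  have hev : ∀ᶠ t in 𝓝[>] (0 : ℝ), 0 < Real.cos (c t).2.1 :=
    nhdsWithin_le_nhds
      ((Real.continuous_cos.comp hc.continuous_phi).continuousAt.eventually_const_lt hcos)
  obtain ⟨ε, hε, hsub⟩ := mem_nhdsGT_iff_exists_Ioo_subset.1 hev
  have hε' : (0 : ℝ) < ε := hε
  refine ⟨ε, hε', fun t ht => ?_⟩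
  have := hc.radius_strictAntiOn hr0 (a := 0) (b := ε) (fun t ht => hsub ht)
    ⟨le_rfl, hε'.le⟩ ⟨ht.1.le, ht.2.le⟩ ht.1
  simpa [h0] using this

/-! ### The change of the angle `ψ` across the block -/

/-- Inside the block `dψ / dφ = r² / (e^{2w} - r²)` is a continuous function of `κ(r)`. -/
theorem IsSmall.exists_scattering_density (hδ : IsSmall h δ) :
    ∃ F : ℝ → ℝ, Continuous F ∧ (∀ u, |F u| ≤ δ ^ 2) ∧
      ∀ s ∈ Set.Icc 0 δ, F (kappa h s) = s ^ 2 / (kinetic h s - s ^ 2) := by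
  have hmono := hδ.strictMonoOn_kappa
  have hmaps : Set.MapsTo (kappa h) (Set.Icc 0 δ) (Set.Icc 0 (kappa h δ)) := by
    intro s hs
    refine ⟨?_, hmono.monotoneOn hs ⟨hδ.pos.le, le_rfl⟩ hs.2⟩
    rw [← kappa_zero h]
    exact hmono.monotoneOn ⟨le_rfl, hδ.pos.le⟩ hs hs.1
  have hκ : 0 ≤ kappa h δ := (hmaps ⟨hδ.pos.le, le_rfl⟩).1
  have hbij : Function.Bijective (hmaps.restrict) := by
    refine ⟨fun a b hab => Subtype.ext (hmono.injOn a.2 b.2 (congrArg Subtype.val hab)), ?_⟩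
    rintro ⟨u, hu⟩
    have := intermediate_value_Icc hδ.pos.le (continuous_kappa h).continuousOn
    rw [kappa_zero] at this
    obtain ⟨s, hs, rfl⟩ := this hu
    exact ⟨⟨s, hs⟩, rfl⟩
  have hcont : Continuous (Equiv.ofBijective _ hbij) :=
    (continuous_kappa h).restrict hmaps
  let e := hcont.homeoOfEquivCompactToT2
  have hk := continuous_kinetic h
  have hden : ∀ s : Set.Icc 0 δ, 1 ≤ kinetic h s - (s : ℝ) ^ 2 := fun s => by
    linarith [hδ.le s s.2]
  have hG : Continuous fun s : Set.Icc 0 δ => (s : ℝ) ^ 2 / (kinetic h s - (s : ℝ) ^ 2) :=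
    Continuous.div (by fun_prop) (by fun_prop) fun s => by linarith [hden s]
  refine ⟨fun u => (fun s : Set.Icc 0 δ => (s : ℝ) ^ 2 / (kinetic h s - (s : ℝ) ^ 2))
    (e.symm (Set.projIcc 0 (kappa h δ) hκ u)), hG.comp (e.symm.continuous.comp continuous_projIcc),
    fun u => ?_, fun s hs => ?_⟩
  · simp only
    generalize e.symm (Set.projIcc 0 (kappa h δ) hκ u) = s
    have h1 := hden s
    have h2 : (s : ℝ) ^ 2 ≤ δ ^ 2 := pow_le_pow_left₀ s.2.1 s.2.2 2
    rw [abs_of_nonneg (div_nonneg (sq_nonneg _) (by linarith))]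
    exact (div_le_self (sq_nonneg _) h1).trans h2
  · have : Set.projIcc 0 (kappa h δ) hκ (kappa h s) = e ⟨s, hs⟩ :=
      Set.projIcc_of_mem hκ (hmaps hs)
    simp only [this, e.symm_apply_apply]

/-- The integral of `F (K sin² a / sin² u)` over `a ≤ u ≤ π - a`, rescaled to a fixed interval. With
`K = κ(δ)` this is the change of `ψ` along an orbit that enters the block `{r ≤ δ}` with `φ = a`. -/
noncomputable def scatter (F : ℝ → ℝ) (K a : ℝ) : ℝ :=
  (Real.pi - 2 * a) *
    ∫ s in (0 : ℝ)..1, F (K * Real.sin a ^ 2 / Real.sin (a + s * (Real.pi - 2 * a)) ^ 2)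

theorem scatter_eq (F : ℝ → ℝ) (K a : ℝ) :
    scatter F K a = ∫ u in a..(Real.pi - a), F (K * Real.sin a ^ 2 / Real.sin u ^ 2) := by
  have := intervalIntegral.smul_integral_comp_add_mul (a := 0) (b := 1)
    (f := fun u => F (K * Real.sin a ^ 2 / Real.sin u ^ 2)) (Real.pi - 2 * a) a
  rw [scatter, ← smul_eq_mul]
  simp only [mul_comm _ (Real.pi - 2 * a)]
  rw [this]
  congr 1 <;> ring

theorem scatter_zero {F : ℝ → ℝ} (hF : F 0 = 0) (K : ℝ) : scatter F K 0 = 0 := by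
  simp [scatter, hF]

/-- Continuity on `[0, π/2]`, the arguments being clamped to this interval. For `a → 0` the
integrand tends to `F 0` at every interior point, so that dominated convergence applies. -/
theorem continuous_scatter {F : ℝ → ℝ} (hF : Continuous F) {C : ℝ} (hC : ∀ u, |F u| ≤ C) (K : ℝ) :
    Continuous fun a => scatter F K (max 0 (min a (Real.pi / 2))) := by
  have hcl : Continuous fun a : ℝ => max 0 (min a (Real.pi / 2)) := by fun_prop
  have hpi := Real.pi_pos
  unfold scatter
  refine Continuous.mul (by fun_prop) ?_
  refine intervalIntegral.continuous_of_dominated_interval (bound := fun _ => C) (fun a => ?_)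
    (fun a => Filter.Eventually.of_forall fun s _ => hC _) intervalIntegrable_const ?_
  · refine Measurable.aestronglyMeasurable ?_
    exact hF.measurable.comp (by fun_prop)
  · have hae : ∀ᵐ s : ℝ, s ≠ 1 := by simp [MeasureTheory.ae_iff]
    filter_upwards [hae] with s hs1 hs
    rw [Set.uIoc_of_le zero_le_one] at hs
    have hs' : s < 1 := lt_of_le_of_ne hs.2 hs1
    refine hF.comp (Continuous.div (by fun_prop) (by fun_prop) fun a => ?_)
    have ha0 : 0 ≤ max 0 (min a (Real.pi / 2)) := le_max_left _ _
    have ha1 : max 0 (min a (Real.pi / 2)) ≤ Real.pi / 2 :=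
      max_le (by positivity) (min_le_right _ _)
    generalize max 0 (min a (Real.pi / 2)) = b at ha0 ha1
    refine (pow_pos (Real.sin_pos_of_mem_Ioo ⟨?_, ?_⟩) 2).ne'
    · nlinarith [hs.1]
    · nlinarith [hs.1]

end LogCentralForce

/-! ### First exit from the block -/

namespace LogCentralForce

open scoped NNReal Topology
open PhaseSpace

variable {h δ : ℝ} {c : ℝ → Cover}

/-- An orbit entering the block with `0 < φ ≤ π/2` leaves it, for the first time, at `π - φ`: on the
boundary the conserved angular momentum determines `sin φ`, and `φ` increases inside the block. -/
theorem IsTraj.crossing (hc : IsTraj h c) (hδ : IsSmall h δ) (h0 : (c 0).1 = δ)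
    (ha : (c 0).2.1 ∈ Set.Ioc 0 (Real.pi / 2)) {F : ℝ → ℝ} (hF : Continuous F)
    (hFκ : ∀ s ∈ Set.Icc 0 δ, F (kappa h s) = s ^ 2 / (kinetic h s - s ^ 2)) {T : ℝ}
    (hT : T = sInf {t | 0 < t ∧ δ < (c t).1}) :
    (c T).1 = δ ∧ (c T).2.1 = Real.pi - (c 0).2.1 ∧
      (c T).2.2.1 = (c 0).2.2.1 + scatter F (kappa h δ) (c 0).2.1 := by
  have hpi := Real.pi_pos
  have hr0 : 0 < (c 0).1 := h0 ▸ hδ.pos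
  have ha' : (c 0).2.1 ∈ Set.Ioo 0 Real.pi := ⟨ha.1, by linarith [ha.2]⟩
  set S := {t | 0 < t ∧ δ < (c t).1} with hS
  have hne : S.Nonempty := hc.exists_exit hδ ⟨hr0, h0.le⟩ ha'
  have hbdd : BddBelow S := ⟨0, fun t ht => ht.1.le⟩
  have hT0 : 0 ≤ T := hT ▸ le_csInf hne fun t ht => ht.1.le
  have hrT : δ ≤ (c T).1 := by
    have hcl : closure S ⊆ {t | δ ≤ (c t).1} := closure_minimal (fun t ht => ht.2.le)
      (isClosed_le continuous_const hc.continuous_radius)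
    exact hcl (hT ▸ csInf_mem_closure hne hbdd)
  have hin' : ∀ t ∈ Set.Ico 0 T, (c t).1 ≤ δ := by
    intro t ht
    rcases ht.1.eq_or_lt with rfl | hpos
    · exact h0.le
    · exact not_lt.1 fun hlt => notMem_of_lt_csInf (hT ▸ ht.2) hbdd ⟨hpos, hlt⟩
  have hin : ∀ t ∈ Set.Icc 0 T, (c t).1 ∈ Set.Icc 0 δ := by
    intro t ht
    refine ⟨hc.radius_nonneg t, ?_⟩
    rcases hT0.eq_or_lt with hz | hpos
    · obtain rfl : t = 0 := le_antisymm (hz ▸ ht.2) ht.1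
      exact h0.le
    · have hcl : closure (Set.Ico 0 T) ⊆ {t | (c t).1 ≤ δ} := closure_minimal hin'
        (isClosed_le hc.continuous_radius continuous_const)
      rw [closure_Ico hpos.ne] at hcl
      exact hcl ht
  have hrT' : (c T).1 = δ := le_antisymm (hin T ⟨hT0, le_rfl⟩).2 hrT
  have hphi := hc.phi_mem ha'
  have hκδ := hδ.kappa_pos ⟨hδ.pos, le_rfl⟩
  have hsin : Real.sin (c T).2.1 = Real.sin (c 0).2.1 := by
    have h1 := hc.kappa_mul_sin_sq hr0 T
    rw [hrT', h0] at h1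
    have h2 := mul_left_cancel₀ hκδ.ne' h1
    exact (pow_left_inj₀ (hc.sin_pos ha' T).le (hc.sin_pos ha' 0).le two_ne_zero).1 h2
  have hphiT : (c T).2.1 = Real.pi - (c 0).2.1 := by
    have hge : Real.pi / 2 ≤ (c T).2.1 := by
      by_contra! hlt
      have heq : (c T).2.1 = (c 0).2.1 := Real.injOn_sin ⟨by linarith [(hphi T).1], hlt.le⟩
        ⟨by linarith [ha.1], ha.2⟩ hsin
      rcases hT0.eq_or_lt with hz | hpos
      · rw [← hz] at hlt
        obtain ⟨ε, hε, hent⟩ := hc.exists_enters hδ.pos h0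
          (Real.cos_pos_of_mem_Ioo ⟨by linarith [ha.1], hlt⟩)
        obtain ⟨s, hs, hsε⟩ := exists_lt_of_csInf_lt hne (hT ▸ hz ▸ hε)
        exact lt_asymm hs.2 (hent s ⟨hs.1, hsε⟩)
      · have hmono : StrictMonoOn (fun t => (c t).2.1) (Set.Icc 0 T) := by
          refine strictMonoOn_of_deriv_pos (convex_Icc _ _) hc.continuous_phi.continuousOn ?_
          intro t ht
          rw [interior_Icc] at ht
          rw [(hc.hasDerivAt_phi t).deriv]
          have h1 := hδ.le _ (hin t (Set.Ioo_subset_Icc_self ht))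
          exact mul_pos (by linarith) (hc.sin_pos ha' t)
        exact (hmono ⟨le_rfl, hT0⟩ ⟨hT0, le_rfl⟩ hpos).ne' heq
    have := Real.injOn_sin (x₁ := Real.pi - (c T).2.1) (x₂ := (c 0).2.1)
      ⟨by linarith [(hphi T).2], by linarith⟩ ⟨by linarith [ha.1], ha.2⟩
      (by rw [Real.sin_pi_sub, hsin])
    linarith
  refine ⟨hrT', hphiT, ?_⟩
  set f : ℝ → ℝ := fun u => F (kappa h δ * Real.sin (c 0).2.1 ^ 2 / Real.sin u ^ 2) with hf
  have hfc : ∀ u ∈ Set.Ioo 0 Real.pi, ContinuousAt f u := by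
    intro u hu
    have : Real.sin u ^ 2 ≠ 0 := (pow_pos (Real.sin_pos_of_mem_Ioo hu) 2).ne'
    refine ContinuousAt.comp (g := F) hF.continuousAt ?_
    fun_prop (disch := assumption)
  have hfm : MeasureTheory.StronglyMeasurable f := by
    refine Measurable.stronglyMeasurable (hF.measurable.comp ?_)
    fun_prop
  -- `ψ - ∫ (dψ/dφ) dφ` is constant up to the exit.
  have hconst := constant_of_has_deriv_right_zero (a := 0) (b := T)
    (f := fun t => (c t).2.2.1 - ∫ u in (c 0).2.1..(c t).2.1, f u)
  have hd : ∀ t ∈ Set.Icc 0 T,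
      HasDerivAt (fun t => (c t).2.2.1 - ∫ u in (c 0).2.1..(c t).2.1, f u) 0 t := by
    intro t ht
    have hint : HasDerivAt (fun b => ∫ u in (c 0).2.1..b, f u) (f (c t).2.1) (c t).2.1 := by
      refine intervalIntegral.integral_hasDerivAt_right (ContinuousOn.intervalIntegrable ?_)
        hfm.stronglyMeasurableAtFilter (hfc _ (hphi t))
      intro u hu
      exact (hfc u (Set.ordConnected_Ioo.uIcc_subset ha' (hphi t) hu)).continuousWithinAt
    refine ((hc.hasDerivAt_psi t).sub (hint.comp t (hc.hasDerivAt_phi t))).congr_deriv ?_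
    have hft : f (c t).2.1 = (c t).1 ^ 2 / (kinetic h (c t).1 - (c t).1 ^ 2) := by
      have hs := (pow_pos (hc.sin_pos ha' t) 2).ne'
      rw [hf, ← hFκ _ (hin t ht)]
      simp only
      rw [← h0, ← hc.kappa_mul_sin_sq hr0 t, mul_div_cancel_right₀ _ hs]
    have h1 : kinetic h (c t).1 - (c t).1 ^ 2 ≠ 0 := by
      have := hδ.le _ (hin t ht)
      linarith
    rw [hft]
    field_simp
    ring
  have := hconst (fun t ht => (hd t ht).continuousAt.continuousWithinAt)
    (fun t ht => (hd t (Set.Ico_subset_Icc_self ht)).hasDerivWithinAt) T ⟨hT0, le_rfl⟩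
  simp only [intervalIntegral.integral_same, sub_zero] at this
  rw [scatter_eq, ← hphiT]
  linarith

/-- The change of `ψ` across the block along orbits that enter with `φ = a`, `|a| ≤ π/2`, extended
by `0` to `a = 0` and, by clamping, to all real `a`: an odd function. -/
noncomputable def turning (F : ℝ → ℝ) (K a : ℝ) : ℝ :=
  scatter F K (max 0 (min a (Real.pi / 2))) - scatter F K (max 0 (min (-a) (Real.pi / 2)))

theorem continuous_turning {F : ℝ → ℝ} (hF : Continuous F) {C : ℝ} (hC : ∀ u, |F u| ≤ C) (K : ℝ) :
    Continuous (turning F K) :=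
  (continuous_scatter hF hC K).sub ((continuous_scatter hF hC K).comp continuous_neg)

theorem turning_zero (F : ℝ → ℝ) (K : ℝ) : turning F K 0 = 0 := by
  simp [turning]

theorem turning_neg (F : ℝ → ℝ) (K a : ℝ) : turning F K (-a) = -turning F K a := by
  simp [turning]

theorem turning_of_mem {F : ℝ → ℝ} (hF : F 0 = 0) (K : ℝ) {a : ℝ}
    (ha : a ∈ Set.Icc 0 (Real.pi / 2)) : turning F K a = scatter F K a := by
  rw [turning, min_eq_left ha.2, max_eq_right ha.1, max_eq_left, scatter_zero hF, sub_zero]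
  exact (min_le_left _ _).trans (by linarith [ha.1])

theorem IsTraj.crossing_angle (hc : IsTraj h c) (hδ : IsSmall h δ) (h0 : (c 0).1 = δ)
    (ha : |(c 0).2.1| ≤ Real.pi / 2) (ha0 : (c 0).2.1 ≠ 0) {F : ℝ → ℝ} (hF : Continuous F)
    (hFκ : ∀ s ∈ Set.Icc 0 δ, F (kappa h s) = s ^ 2 / (kinetic h s - s ^ 2)) {T : ℝ}
    (hT : T = sInf {t | 0 < t ∧ δ < (c t).1}) :
    (c T).1 = δ ∧ ((c T).2.1 : Real.Angle) = Real.pi - ((c 0).2.1 : Real.Angle) ∧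
      (c T).2.2.1 = (c 0).2.2.1 + turning F (kappa h δ) (c 0).2.1 := by
  have hF0 : F 0 = 0 := by
    simpa [kappa_zero] using hFκ 0 ⟨le_rfl, hδ.pos.le⟩
  rw [abs_le] at ha
  rcases ha0.lt_or_gt with hneg | hpos
  · obtain ⟨h1, h2, h3⟩ :=
      hc.reflect.crossing hδ h0 ⟨by simpa using hneg, by linarith [ha.1]⟩ hF hFκ hT
    refine ⟨h1, ?_, ?_⟩
    · have : (c T).2.1 = -Real.pi - (c 0).2.1 := by linarith
      rw [this]
      simp
    · rw [← neg_neg (c 0).2.1, turning_neg, turning_of_mem hF0 _ ⟨by linarith, by linarith [ha.1]⟩]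
      linarith
  · obtain ⟨h1, h2, h3⟩ := hc.crossing hδ h0 ⟨hpos, ha.2⟩ hF hFκ hT
    exact ⟨h1, by rw [h2]; simp, by rw [h3, turning_of_mem hF0 _ ⟨hpos.le, ha.2⟩]⟩

/-! ### Escape from the block -/

theorem IsTraj.exists_exit_of_sin_ne_zero (hc : IsTraj h c) (hδ : IsSmall h δ)
    (hr : (c 0).1 ∈ Set.Ioc 0 δ) (h0 : Real.sin (c 0).2.1 ≠ 0) : ∃ t, 0 < t ∧ δ < (c t).1 := by
  have hsub : ∀ (c : ℝ → Cover), IsTraj h c → (c 0).1 ∈ Set.Ioc 0 δ → 0 < Real.sin (c 0).2.1 →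
      ∃ t, 0 < t ∧ δ < (c t).1 := by
    intro c hc hr hs
    let b : Cover := ((c 0).1, ((c 0).2.1 : Real.Angle).toReal, (c 0).2.2.1, (c 0).2.2.2)
    have hb : proj (c 0) = proj b := by simp [proj, b]
    have hbphi : b.2.1 ∈ Set.Ioo 0 Real.pi := by
      have hsb : 0 < Real.sin b.2.1 := by simpa [b] using hs
      have hle : b.2.1 ≤ Real.pi := Real.Angle.toReal_le_pi ((c 0).2.1 : Real.Angle)
      have hge : -Real.pi ≤ b.2.1 := (Real.Angle.neg_pi_lt_toReal ((c 0).2.1 : Real.Angle)).le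
      refine ⟨not_le.1 fun hn => hsb.not_ge (Real.sin_nonpos_of_nonpos_of_neg_pi_le hn hge),
        lt_of_le_of_ne hle fun heq => ?_⟩
      rw [heq, Real.sin_pi] at hsb
      exact lt_irrefl _ hsb
    obtain ⟨t, ht, hlt⟩ := (hc.deck hb).exists_exit hδ (by simpa [b] using hr)
      (by simpa using hbphi)
    exact ⟨t, ht, by simpa [b] using hlt⟩
  rcases h0.lt_or_gt with hneg | hpos
  · exact hsub (fun t => ((c t).1, -(c t).2.1, -(c t).2.2.1, (c t).2.2.2)) hc.reflect hr
      (by simpa using hneg)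
  · exact hsub c hc hr hpos

/-- On the invariant set `φ = π`, `r` increases, so that inside the block `r'` stays above a
positive constant. -/
theorem IsTraj.exists_exit_of_cos_neg (hc : IsTraj h c) (hδ : IsSmall h δ)
    (hr : (c 0).1 ∈ Set.Ioc 0 δ) (h0 : Real.sin (c 0).2.1 = 0) (h1 : Real.cos (c 0).2.1 < 0) :
    ∃ t, 0 < t ∧ δ < (c t).1 := by
  by_contra! hle
  have hcos : ∀ t, Real.cos (c t).2.1 = -1 := by
    intro t
    rw [hc.phi_const h0]
    have := Real.sin_sq_add_cos_sq (c 0).2.1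
    rw [h0] at this
    nlinarith
  have hge : ∀ t, 0 < t → (c 0).1 ≤ (c t).1 := fun t ht =>
    (hc.radius_strictMonoOn hr.1 (a := 0) (b := t) (fun s _ => by rw [hcos]; norm_num)
      ⟨le_rfl, ht.le⟩ ⟨ht.le, le_rfl⟩ ht).le
  set η := (c 0).1 ^ 3 / (δ ^ 2 + 2) with hη
  have hηpos : 0 < η := by have := hr.1; positivity
  have hmono : MonotoneOn (fun t => (c t).1 - η * t) (Set.Ici 0) := by
    have hd : ∀ t, HasDerivAt (fun t => (c t).1 - η * t) _ t := fun t =>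
      (hc.hasDerivAt_radius t).sub ((hasDerivAt_id t).const_mul η)
    refine monotoneOn_of_deriv_nonneg (convex_Ici 0)
      (fun t _ => (hd t).continuousAt.continuousWithinAt)
      (fun t _ => (hd t).differentiableAt.differentiableWithinAt) (fun t ht => ?_)
    rw [interior_Ici] at ht
    rw [(hd t).deriv, hcos, hc.exp_eq]
    have hrt : (c t).1 ∈ Set.Icc 0 δ := ⟨hc.radius_nonneg t, hle t ht⟩
    have h2 : 1 ≤ kinetic h (c t).1 := by nlinarith [hδ.le _ hrt]
    have h3 : η ≤ (c t).1 ^ 3 / ((c t).1 ^ 2 + 2) :=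
      div_le_div₀ (pow_nonneg hrt.1 3) (pow_le_pow_left₀ hr.1.le (hge t ht) 3) (by positivity)
        (by linarith [pow_le_pow_left₀ hrt.1 hrt.2 2])
    nlinarith
  have hT : 0 < δ / η := div_pos hδ.pos hηpos
  have := hmono Set.self_mem_Ici (Set.mem_Ici.2 hT.le) hT.le
  simp only [mul_zero, sub_zero, mul_div_cancel₀ _ hηpos.ne'] at this
  linarith [hle _ hT, hr.1]

end LogCentralForce

/-! ### The energy level over the block -/

namespace LogCentralForce

open scoped NNReal Topology
open PhaseSpace

variable {h δ : ℝ} {Φ : Flow ℝ (energySurface h)}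

theorem continuous_r : Continuous r := by unfold r; fun_prop

theorem continuous_φ : Continuous φ := by unfold φ; fun_prop

/-- On the energy level `w` is a function of `r`. -/
theorem w_eq_log {x : PhaseSpace} (hx : x ∈ energySurface h) :
    w x = Real.log (kinetic h (r x)) / 2 := by
  rw [← (mem_energySurface_iff.1 hx).2, Real.log_exp]
  ring

theorem isClosed_block : IsClosed (block h δ) :=
  isClosed_le (continuous_r.comp continuous_subtype_val) continuous_const

theorem IsSmall.kinetic_pos (hδ : IsSmall h δ) {s : ℝ} (hs : s ∈ Set.Icc 0 δ) :
    0 < kinetic h s := by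
  have := hδ.le s hs
  linarith [sq_nonneg s]

/-- The point of the energy level with given `r ≤ δ` and angles. -/
noncomputable def graphPoint (hδ : IsSmall h δ) (p : Set.Icc 0 δ × Real.Angle × Real.Angle) :
    energySurface h :=
  ⟨(p.1, p.2.1, p.2.2, Real.log (kinetic h p.1) / 2), mem_energySurface_iff.2 ⟨p.1.2.1, by
    simp only [w, r, mul_div_cancel₀ _ (two_ne_zero (α := ℝ)),
      Real.exp_log (hδ.kinetic_pos p.1.2)]⟩⟩

theorem continuous_graphPoint (hδ : IsSmall h δ) : Continuous (graphPoint hδ) := by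
  have hk := continuous_kinetic h
  have h1 : Continuous fun p : Set.Icc 0 δ × Real.Angle × Real.Angle =>
      Real.log (kinetic h p.1) :=
    Continuous.log (by fun_prop) fun p => (hδ.kinetic_pos p.1.2).ne'
  unfold graphPoint
  exact Continuous.subtype_mk (by fun_prop) _

theorem range_graphPoint (hδ : IsSmall h δ) : Set.range (graphPoint hδ) = block h δ := by
  ext x
  constructor
  · rintro ⟨p, rfl⟩
    exact p.1.2.2
  · intro hx
    refine ⟨(⟨r x, (mem_energySurface_iff.1 x.2).1, hx⟩, φ x, ψ x), Subtype.ext ?_⟩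
    simp only [graphPoint, ← w_eq_log x.2]
    rfl

theorem isCompact_block (hδ : IsSmall h δ) : IsCompact (block h δ) := by
  have : Fact (0 < 2 * Real.pi) := ⟨Real.two_pi_pos⟩
  have : CompactSpace Real.Angle := inferInstanceAs (CompactSpace (AddCircle (2 * Real.pi)))
  rw [← range_graphPoint hδ]
  exact isCompact_range (continuous_graphPoint hδ)

/-- A trajectory in the cover over a given orbit, with initial `φ` in `(-π, π]`. -/
theorem IsRegularisedFlow.exists_lift (hΦ : IsRegularisedFlow h Φ) (x : energySurface h) :
    ∃ c, IsTraj h c ∧ (∀ t, proj (c t) = Φ t x) ∧ (c 0).1 = r (x : PhaseSpace) ∧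
      (c 0).2.1 = (φ (x : PhaseSpace)).toReal := by
  obtain ⟨c, hc, hcΦ⟩ := hΦ.exists_traj x
  have hx : proj (c 0) = x := by rw [hcΦ, Φ.map_zero_apply]
  let b : Cover := ((c 0).1, (φ (x : PhaseSpace)).toReal, (c 0).2.2.1, (c 0).2.2.2)
  have hb : proj (c 0) = proj b := by
    have : φ (proj (c 0)) = φ (x : PhaseSpace) := by rw [hx]
    simpa [proj, b, φ] using this
  refine ⟨_, hc.deck hb, fun t => ?_, ?_, by simp [b]⟩
  · rw [← hcΦ]
    refine (hc.deck hb).proj_eq hc ?_ t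
    simp [hb]
  · simp only [add_sub_cancel, b]
    rw [← hx]
    rfl

theorem radius_eq {c : ℝ → Cover} {x : energySurface h} (hcΦ : ∀ t, proj (c t) = Φ t x) (t : ℝ) :
    r (Φ t x : PhaseSpace) = (c t).1 := by
  rw [← hcΦ]
  rfl

/-- Orbits outside the block right after time `0`: the tangency case `cos φ = 0` is included. -/
theorem exits_iff (hΦ : IsRegularisedFlow h Φ) (hδ : IsSmall h δ) {x : energySurface h}
    (hx : r (x : PhaseSpace) = δ) :
    (∃ ε > 0, ∀ t ∈ Set.Ioo 0 ε, Φ t x ∉ block h δ) ↔ (φ (x : PhaseSpace)).cos ≤ 0 := by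
  obtain ⟨c, hc, hcΦ, hr, hφ⟩ := hΦ.exists_lift x
  rw [hx] at hr
  simp only [block, Set.mem_ofPred_eq, radius_eq hcΦ, not_le, ← Real.Angle.cos_toReal, ← hφ]
  refine ⟨fun ⟨ε, hε, hout⟩ => ?_, fun hcos => hc.exists_exits hδ hr hcos⟩
  by_contra! hcos
  obtain ⟨ε', hε', hin⟩ := hc.exists_enters hδ.pos hr hcos
  have hm : 0 < min ε ε' / 2 := by positivity
  have := min_le_left ε ε'
  have := min_le_right ε ε'
  exact lt_asymm (hout _ ⟨hm, by linarith⟩) (hin _ ⟨hm, by linarith⟩)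

/-- Orbits outside the block right before time `0`; by reversibility. -/
theorem enters_iff (hΦ : IsRegularisedFlow h Φ) (hδ : IsSmall h δ) {x : energySurface h}
    (hx : r (x : PhaseSpace) = δ) :
    (∃ ε > 0, ∀ t ∈ Set.Ioo (-ε) 0, Φ t x ∉ block h δ) ↔ 0 ≤ (φ (x : PhaseSpace)).cos := by
  obtain ⟨c, hc, hcΦ, hr, hφ⟩ := hΦ.exists_lift x
  rw [hx] at hr
  simp only [block, Set.mem_ofPred_eq, radius_eq hcΦ, not_le, ← Real.Angle.cos_toReal, ← hφ]
  have hr' : (c (-0)).1 = δ := by rwa [neg_zero]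
  refine ⟨fun ⟨ε, hε, hout⟩ => ?_, fun hcos => ?_⟩
  · by_contra! hcos
    obtain ⟨ε', hε', hin⟩ := hc.reverse.exists_enters hδ.pos hr'
      (by simpa [Real.cos_pi_sub] using hcos)
    have hm : 0 < min ε ε' / 2 := by positivity
    have := min_le_left ε ε'
    have := min_le_right ε ε'
    exact lt_asymm (hout (-(min ε ε' / 2)) ⟨by linarith, by linarith⟩)
      (hin _ ⟨hm, by linarith⟩)
  · obtain ⟨ε, hε, hout⟩ := hc.reverse.exists_exits hδ hr'
      (by simpa [Real.cos_pi_sub] using hcos)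
    refine ⟨ε, hε, fun t ht => ?_⟩
    simpa using hout (-t) ⟨by linarith [ht.2], by linarith [ht.1]⟩

theorem interior_block (hΦ : IsRegularisedFlow h Φ) (hδ : IsSmall h δ) :
    interior (block h δ) = {x : energySurface h | r (x : PhaseSpace) < δ} := by
  refine Set.Subset.antisymm (fun x hx => ?_) (interior_maximal
    (fun x (hx : r (x : PhaseSpace) < δ) => hx.le)
    (isOpen_lt (continuous_r.comp continuous_subtype_val) continuous_const))
  have hxB : x ∈ block h δ := interior_subset hx
  have hle : r (x : PhaseSpace) ≤ δ := hxB
  refine lt_of_le_of_ne hle fun heq => ?_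
  have hcont : Continuous fun t => Φ t x := by fun_prop
  have hev : ∀ᶠ t in 𝓝 (0 : ℝ), Φ t x ∈ block h δ := by
    refine hcont.continuousAt.eventually_mem ?_
    rw [Φ.map_zero_apply]
    exact mem_interior_iff_mem_nhds.1 hx
  obtain ⟨ε, hε, hball⟩ := Metric.eventually_nhds_iff.1 hev
  -- From a boundary point the orbit is outside the block right after or right before time `0`.
  rcases le_total (φ (x : PhaseSpace)).cos 0 with hcos | hcos
  · obtain ⟨ε', hε', hout⟩ := (exits_iff hΦ hδ heq).2 hcos
    have hm : 0 < min ε ε' / 2 := by positivity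
    have := min_le_left ε ε'
    have := min_le_right ε ε'
    refine hout (min ε ε' / 2) ⟨hm, by linarith⟩ (hball ?_)
    rw [Real.dist_0_eq_abs, abs_of_pos hm]
    linarith
  · obtain ⟨ε', hε', hout⟩ := (enters_iff hΦ hδ heq).2 hcos
    have hm : 0 < min ε ε' / 2 := by positivity
    have := min_le_left ε ε'
    have := min_le_right ε ε'
    refine hout (-(min ε ε' / 2)) ⟨by linarith, by linarith⟩ (hball ?_)
    rw [Real.dist_0_eq_abs, abs_neg, abs_of_pos hm]
    linarith

theorem frontier_block (hΦ : IsRegularisedFlow h Φ) (hδ : IsSmall h δ) :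
    frontier (block h δ) = {x : energySurface h | r (x : PhaseSpace) = δ} := by
  rw [isClosed_block.frontier_eq, interior_block hΦ hδ]
  ext x
  simp only [block, Set.mem_sdiff, Set.mem_ofPred_eq, not_lt]
  exact ⟨fun hx => le_antisymm hx.1 hx.2, fun hx => ⟨hx.le, hx.ge⟩⟩

theorem bPlus_block (hΦ : IsRegularisedFlow h Φ) (hδ : IsSmall h δ) :
    bPlus Φ (block h δ) =
      {x : energySurface h | r (x : PhaseSpace) = δ ∧ 0 ≤ (φ (x : PhaseSpace)).cos} := by
  ext x
  rw [bPlus, frontier_block hΦ hδ]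
  exact and_congr_right fun hx => enters_iff hΦ hδ hx

theorem bMinus_block (hΦ : IsRegularisedFlow h Φ) (hδ : IsSmall h δ) :
    bMinus Φ (block h δ) =
      {x : energySurface h | r (x : PhaseSpace) = δ ∧ (φ (x : PhaseSpace)).cos ≤ 0} := by
  ext x
  rw [bMinus, frontier_block hΦ hδ]
  exact and_congr_right fun hx => exits_iff hΦ hδ hx

theorem aPlus_block (hΦ : IsRegularisedFlow h Φ) (hδ : IsSmall h δ) :
    aPlus Φ (block h δ) =
      {x : energySurface h | r (x : PhaseSpace) = δ ∧ φ (x : PhaseSpace) = 0} := by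
  ext x
  rw [aPlus, bPlus_block hΦ hδ]
  obtain ⟨c, hc, hcΦ, hr, hφ⟩ := hΦ.exists_lift x
  simp only [block, Set.mem_ofPred_eq, radius_eq hcΦ]
  constructor
  · rintro ⟨⟨hx, hcos⟩, hin⟩
    refine ⟨hx, ?_⟩
    have hsin : (φ (x : PhaseSpace)).sin = 0 := by
      rw [← Real.Angle.sin_toReal, ← hφ]
      by_contra hne
      obtain ⟨t, ht, hlt⟩ := hc.exists_exit_of_sin_ne_zero hδ
        ⟨by rw [hr, hx]; exact hδ.pos, by rw [hr, hx]⟩ hne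
      exact hlt.not_ge (hin t ht.le)
    rcases Real.Angle.sin_eq_zero_iff.1 hsin with h0 | h0
    · exact h0
    · rw [h0, Real.Angle.cos_coe_pi] at hcos
      norm_num at hcos
  · rintro ⟨hx, h0⟩
    rw [hx] at hr
    rw [h0, Real.Angle.toReal_zero] at hφ
    refine ⟨⟨hx, by rw [h0, Real.Angle.cos_zero]; exact zero_le_one⟩, fun t ht => ?_⟩
    have hcos : ∀ s, 0 < Real.cos (c s).2.1 := fun s => by
      rw [hc.phi_const (by rw [hφ, Real.sin_zero]), hφ, Real.cos_zero]
      exact zero_lt_one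
    have := (hc.radius_strictAntiOn (hr ▸ hδ.pos) (a := 0) (b := t) fun s _ => hcos s).antitoneOn
      ⟨le_rfl, ht⟩ ⟨ht, le_rfl⟩ ht
    rwa [hr] at this

theorem aMinus_block (hΦ : IsRegularisedFlow h Φ) (hδ : IsSmall h δ) :
    aMinus Φ (block h δ) =
      {x : energySurface h |
        r (x : PhaseSpace) = δ ∧ φ (x : PhaseSpace) = (Real.pi : Real.Angle)} := by
  ext x
  rw [aMinus, bMinus_block hΦ hδ]
  obtain ⟨c, hc, hcΦ, hr, hφ⟩ := hΦ.exists_lift x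
  simp only [block, Set.mem_ofPred_eq, radius_eq hcΦ]
  constructor
  · rintro ⟨⟨hx, hcos⟩, hin⟩
    refine ⟨hx, ?_⟩
    have hsin : (φ (x : PhaseSpace)).sin = 0 := by
      rw [← Real.Angle.sin_toReal, ← hφ]
      by_contra hne
      obtain ⟨t, ht, hlt⟩ := hc.reverse.exists_exit_of_sin_ne_zero hδ
        ⟨by simpa [hr, hx] using hδ.pos, by simp [hr, hx]⟩ (by simpa using hne)
      exact hlt.not_ge (hin (-t) (by linarith))
    rcases Real.Angle.sin_eq_zero_iff.1 hsin with h0 | h0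
    · rw [h0, Real.Angle.cos_zero] at hcos
      norm_num at hcos
    · exact h0
  · rintro ⟨hx, h0⟩
    rw [hx] at hr
    rw [h0, Real.Angle.toReal_pi] at hφ
    refine ⟨⟨hx, by rw [h0, Real.Angle.cos_coe_pi]; norm_num⟩, fun t ht => ?_⟩
    have hcos : ∀ s, Real.cos (c s).2.1 < 0 := fun s => by
      rw [hc.phi_const (by rw [hφ, Real.sin_pi]), hφ, Real.cos_pi]
      norm_num
    have := (hc.radius_strictMonoOn (hr ▸ hδ.pos) (a := t) (b := 0) fun s _ => hcos s).monotoneOn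
      ⟨le_rfl, ht⟩ ⟨ht, le_rfl⟩ ht
    rwa [hr] at this

/-! ### The block isolates the collision manifold -/

theorem mem_collisionManifold_iff {x : energySurface h} :
    x ∈ collisionManifold h ↔ r (x : PhaseSpace) = 0 := by
  refine ⟨fun hx => hx.1, fun hx => ⟨hx, ?_⟩⟩
  rw [(mem_energySurface_iff.1 x.2).2, hx, kinetic_zero]

theorem isIsolatingNhd_block (hΦ : IsRegularisedFlow h Φ) (hδ : IsSmall h δ) :
    IsIsolatingNhd Φ (collisionManifold h) (interior (block h δ)) := by
  refine ⟨isOpen_interior, fun x hx => ?_, fun x hx => ?_⟩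
  · rw [interior_block hΦ hδ]
    exact (mem_collisionManifold_iff.1 hx).trans_lt hδ.pos
  · obtain ⟨c, hc, hcΦ, hr, hφ⟩ := hΦ.exists_lift x
    simp only [interior_block hΦ hδ, Set.mem_ofPred_eq, radius_eq hcΦ] at hx
    rw [mem_collisionManifold_iff, ← hr]
    by_contra hne
    have hr0 : (c 0).1 ∈ Set.Ioc 0 δ :=
      ⟨lt_of_le_of_ne (hc.radius_nonneg 0) (Ne.symm hne), (hx 0).le⟩
    by_cases hsin : Real.sin (c 0).2.1 = 0
    · have hcos : Real.cos (c 0).2.1 ≠ 0 := fun h0 => by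
        have := Real.sin_sq_add_cos_sq (c 0).2.1
        rw [hsin, h0] at this
        norm_num at this
      rcases hcos.lt_or_gt with hneg | hpos
      · obtain ⟨t, -, hlt⟩ := hc.exists_exit_of_cos_neg hδ hr0 hsin hneg
        exact lt_asymm hlt (hx t)
      · obtain ⟨t, -, hlt⟩ := hc.reverse.exists_exit_of_cos_neg hδ (by simpa using hr0)
          (by simpa using hsin) (by simpa [Real.cos_pi_sub] using hpos)
        exact lt_asymm hlt (hx (-t))
    · obtain ⟨t, -, hlt⟩ := hc.exists_exit_of_sin_ne_zero hδ hr0 hsin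
      exact lt_asymm hlt (hx t)

theorem isolates_block (hΦ : IsRegularisedFlow h Φ) (hδ : IsSmall h δ) :
    Isolates Φ (block h δ) (collisionManifold h) := by
  refine ⟨⟨?_, fun x hx t => ?_, _, isIsolatingNhd_block hΦ hδ⟩, isIsolatingNhd_block hΦ hδ⟩
  · have hcl : IsClosed {x : energySurface h | r (x : PhaseSpace) = 0} :=
      isClosed_eq (continuous_r.comp continuous_subtype_val) continuous_const
    have heq : collisionManifold h = {x : energySurface h | r (x : PhaseSpace) = 0} :=
      Set.ext fun x => mem_collisionManifold_iff
    rw [heq]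
    exact (isCompact_block hδ).of_isClosed_subset hcl fun x hx => by
      have hx' : r (x : PhaseSpace) = 0 := hx
      exact hx'.le.trans hδ.pos.le
  · obtain ⟨c, hc, hcΦ, hr, -⟩ := hΦ.exists_lift x
    obtain ⟨m, -, hm⟩ := hc.exists_radius_factor
    rw [mem_collisionManifold_iff] at hx ⊢
    rw [radius_eq hcΦ, hm, hr, hx, zero_mul]

/-! ### The block is an isolating block -/

theorem proj_mem_image_frontier (hΦ : IsRegularisedFlow h Φ) (hδ : IsSmall h δ) (z : Cover) :
    proj z ∈ (fun y : energySurface h => (y : PhaseSpace)) '' frontier (block h δ) ↔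
      z.1 = δ ∧ z.2.2.2 = Real.log (kinetic h δ) / 2 := by
  rw [frontier_block hΦ hδ]
  constructor
  · rintro ⟨x, hx, hxz⟩
    have hx' : r (x : PhaseSpace) = δ := hx
    have hw := w_eq_log x.2
    simp only at hxz
    rw [hx'] at hw
    rw [hxz] at hx' hw
    exact ⟨hx', hw⟩
  · rintro ⟨h1, h2⟩
    have hmem : proj z ∈ energySurface h := by
      rw [mem_energySurface_iff]
      simp only [proj, r, w, h1, h2, mul_div_cancel₀ _ (two_ne_zero (α := ℝ))]
      exact ⟨hδ.pos.le, Real.exp_log (hδ.kinetic_pos ⟨hδ.pos.le, le_rfl⟩)⟩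
    exact ⟨⟨_, hmem⟩, h1, rfl⟩

theorem isSmoothSurface_frontier (hΦ : IsRegularisedFlow h Φ) (hδ : IsSmall h δ) :
    IsSmoothSurface ((fun y : energySurface h => (y : PhaseSpace)) '' frontier (block h δ)) := by
  intro y _
  let L : Cover →L[ℝ] ℝ × ℝ := (ContinuousLinearMap.fst ℝ ℝ (ℝ × ℝ × ℝ)).prod
    ((ContinuousLinearMap.snd ℝ ℝ ℝ).comp ((ContinuousLinearMap.snd ℝ ℝ (ℝ × ℝ)).comp
      (ContinuousLinearMap.snd ℝ ℝ (ℝ × ℝ × ℝ))))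
  refine ⟨Set.univ, isOpen_univ, trivial,
    fun z => L z - (δ, Real.log (kinetic h δ) / 2), ?_, ?_, fun z _ => ?_⟩
  · exact (L.contDiff.sub contDiff_const).contDiffOn
  · have : fderiv ℝ (fun z => L z - (δ, Real.log (kinetic h δ) / 2)) y = L := by
      rw [fderiv_sub_const, L.fderiv]
    rw [this]
    exact fun p => ⟨(p.1, 0, 0, p.2), rfl⟩
  · rw [proj_mem_image_frontier hΦ hδ, sub_eq_zero, Prod.ext_iff]
    exact Iff.rfl

/-- The vector field is tangent to `{r = δ}` exactly where `r' = 0`, that is, where `cos φ = 0`. -/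
theorem tangencySet_block (hΦ : IsRegularisedFlow h Φ) (hδ : IsSmall h δ) :
    tangencySet (block h δ) = bPlus Φ (block h δ) ∩ bMinus Φ (block h δ) := by
  ext x
  rw [bPlus_block hΦ hδ, bMinus_block hΦ hδ, tangencySet, Set.mem_ofPred_eq]
  have hδp := hδ.pos
  constructor
  · rintro ⟨hx, c, hc0, hcS, hcd⟩
    rw [frontier_block hΦ hδ] at hx
    have hx' : r (x : PhaseSpace) = δ := hx
    have h1 := (hasDerivAt_cover.1 hcd).1
    have h2 : HasDerivAt (fun s => (c s).1) 0 0 := by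
      refine (hasDerivAt_const (0 : ℝ) δ).congr_of_eventuallyEq ?_
      filter_upwards [hcS] with s hs
      exact ((proj_mem_image_frontier hΦ hδ _).1 hs).1
    have h3 := h1.unique h2
    simp only [regField, hx'] at h3
    have hcos : (φ (x : PhaseSpace)).cos = 0 := by
      have h4 : -(δ ^ 3 / (δ ^ 2 + 2)) * Real.exp (2 * w (x : PhaseSpace)) ≠ 0 :=
        mul_ne_zero (neg_ne_zero.2 (by positivity)) (Real.exp_pos _).ne'
      exact (mul_eq_zero.1 h3).resolve_left h4
    exact ⟨⟨hx', hcos.ge⟩, ⟨hx', hcos.le⟩⟩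
  · rintro ⟨⟨hx, h1⟩, ⟨-, h2⟩⟩
    have hcos := le_antisymm h2 h1
    have hfr : x ∈ frontier (block h δ) := by rw [frontier_block hΦ hδ]; exact hx
    refine ⟨hfr, fun s => liftNear x x + s • regField x, by simp [proj_liftNear],
      Filter.Eventually.of_forall fun s => ?_, ?_⟩
    · rw [proj_mem_image_frontier hΦ hδ]
      have := (proj_mem_image_frontier hΦ hδ (liftNear x x)).1
        (by rw [proj_liftNear]; exact ⟨x, hfr, rfl⟩)
      simpa [regField, hcos] using this
    · simpa using ((hasDerivAt_id (0 : ℝ)).smul_const (regField (x : PhaseSpace))).const_add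
        (liftNear x x)

theorem isIsolatingBlock_block (hΦ : IsRegularisedFlow h Φ) (hδ : IsSmall h δ) :
    IsIsolatingBlock Φ (block h δ) := by
  refine ⟨isCompact_block hδ, ?_, isSmoothSurface_frontier hΦ hδ, tangencySet_block hΦ hδ⟩
  rw [interior_block hΦ hδ]
  exact ⟨graphPoint hδ (⟨0, le_rfl, hδ.pos.le⟩, 0, 0), hδ.pos⟩

/-! ### The map across the block -/

/-- Off `φ = 0` the map across the block is `(φ, ψ) ↦ (π - φ, ψ + Δ(φ))`. -/
theorem mapAcross_eq (hΦ : IsRegularisedFlow h Φ) (hδ : IsSmall h δ) {F : ℝ → ℝ} (hF : Continuous F)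
    (hFκ : ∀ s ∈ Set.Icc 0 δ, F (kappa h s) = s ^ 2 / (kinetic h s - s ^ 2)) {x : energySurface h}
    (hx : r (x : PhaseSpace) = δ) (hcos : 0 ≤ (φ (x : PhaseSpace)).cos)
    (h0 : φ (x : PhaseSpace) ≠ 0) :
    ((mapAcross Φ (block h δ) x : energySurface h) : PhaseSpace) =
      (r (x : PhaseSpace), Real.pi - φ (x : PhaseSpace), ψ (x : PhaseSpace) +
        (turning F (kappa h δ) (φ (x : PhaseSpace)).toReal : Real.Angle), w (x : PhaseSpace)) := by
  obtain ⟨c, hc, hcΦ, hr, hφ⟩ := hΦ.exists_lift x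
  have hT : exitTime Φ (block h δ) x = sInf {t | 0 < t ∧ δ < (c t).1} := by
    simp only [exitTime, block, Set.mem_ofPred_eq, radius_eq hcΦ, not_le]
  obtain ⟨h1, h2, h3⟩ := hc.crossing_angle hδ (hr.trans hx)
    (by rw [hφ]; exact Real.Angle.cos_nonneg_iff_abs_toReal_le_pi_div_two.1 hcos)
    (by rw [hφ]; exact fun h => h0 (Real.Angle.toReal_eq_zero_iff.1 h)) hF hFκ hT
  have hx0 : proj (c 0) = x := by rw [hcΦ, Φ.map_zero_apply]
  have hψ : ((c 0).2.2.1 : Real.Angle) = ψ (x : PhaseSpace) := by rw [← hx0]; rfl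
  have hwT := w_eq_log (Φ (exitTime Φ (block h δ) x) x).2
  have hw := w_eq_log x.2
  rw [hx] at hw
  rw [radius_eq hcΦ, h1, ← hw] at hwT
  rw [mapAcross]
  rw [← hcΦ] at hwT ⊢
  refine Prod.ext (h1.trans hx.symm) (Prod.ext ?_ (Prod.ext ?_ hwT))
  · simpa [proj, hφ] using h2
  · simp only [proj, h3, hφ, Real.Angle.coe_add, hψ]

/-- The extension is `(φ, ψ) ↦ (π - φ, ψ + Δ(φ))`, with inverse `(φ, ψ) ↦ (π - φ, ψ - Δ(π - φ))`. It
is continuous because `Δ` is and because `φ ↦ φ.toReal` is continuous where `cos φ ≥ 0`. -/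
theorem exists_homeomorph_mapAcross (hΦ : IsRegularisedFlow h Φ) (hδ : IsSmall h δ) :
    ∃ e : bPlus Φ (block h δ) ≃ₜ bMinus Φ (block h δ), ExtendsMapAcross Φ (block h δ) e ∧
      ∀ x, x.1 ∈ aPlus Φ (block h δ) →
        (e x).1.1 = (δ, (Real.pi : Real.Angle), x.1.1.ψ, x.1.1.w) := by
  obtain ⟨F, hF, hFb, hFκ⟩ := hδ.exists_scattering_density
  have hΔc := continuous_turning hF hFb (kappa h δ)
  have hΔ0 := turning_zero F (kappa h δ)
  generalize hΔ : turning F (kappa h δ) = Δ at hΔc hΔ0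
  have hP := bPlus_block hΦ hδ
  have hM := bMinus_block hΦ hδ
  have hmem : ∀ (x : energySurface h) (a b : Real.Angle),
      (r (x : PhaseSpace), a, b, w (x : PhaseSpace)) ∈ energySurface h := fun x a b =>
    mem_energySurface_iff.2 (mem_energySurface_iff.1 x.2)
  have hp : ∀ x : bPlus Φ (block h δ), r (x.1 : PhaseSpace) = δ ∧ 0 ≤ (φ (x.1 : PhaseSpace)).cos :=
    fun x => hP.subset x.2
  have hm : ∀ x : bMinus Φ (block h δ), r (x.1 : PhaseSpace) = δ ∧ (φ (x.1 : PhaseSpace)).cos ≤ 0 :=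
    fun x => hM.subset x.2
  have hcos : ∀ θ : Real.Angle, ((Real.pi : Real.Angle) - θ).cos = -θ.cos := fun θ => by
    rw [sub_eq_neg_add, Real.Angle.cos_add_pi, Real.Angle.cos_neg]
  let f : bPlus Φ (block h δ) → bMinus Φ (block h δ) := fun x =>
    ⟨⟨(r (x.1 : PhaseSpace), Real.pi - φ (x.1 : PhaseSpace), ψ (x.1 : PhaseSpace) +
      (Δ (φ (x.1 : PhaseSpace)).toReal : Real.Angle), w (x.1 : PhaseSpace)), hmem _ _ _⟩,
      hM.superset ⟨(hp x).1, by
        simp only [φ, hcos]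
        exact neg_nonpos.2 (hp x).2⟩⟩
  let g : bMinus Φ (block h δ) → bPlus Φ (block h δ) := fun x =>
    ⟨⟨(r (x.1 : PhaseSpace), Real.pi - φ (x.1 : PhaseSpace), ψ (x.1 : PhaseSpace) -
      (Δ (Real.pi - φ (x.1 : PhaseSpace)).toReal : Real.Angle), w (x.1 : PhaseSpace)), hmem _ _ _⟩,
      hP.superset ⟨(hm x).1, by
        simp only [φ, hcos]
        exact neg_nonneg.2 (hm x).2⟩⟩
  have hreal : ∀ θ : Real.Angle, 0 ≤ θ.cos →
      ContinuousAt (fun θ => (Δ θ.toReal : Real.Angle)) θ := by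
    intro θ hθ
    have hne : θ ≠ (Real.pi : Real.Angle) := by
      rintro rfl
      rw [Real.Angle.cos_coe_pi] at hθ
      norm_num at hθ
    exact ContinuousAt.comp (g := fun a => (Δ a : Real.Angle))
      (Real.Angle.continuous_coe.comp hΔc).continuousAt (continuousAt_toReal hne)
  have hf : Continuous f := by
    refine Continuous.subtype_mk (Continuous.subtype_mk ?_ _) _
    have h1 : Continuous fun x : bPlus Φ (block h δ) =>
        (Δ (φ (x.1 : PhaseSpace)).toReal : Real.Angle) :=
      continuous_iff_continuousAt.2 fun x => ContinuousAt.comp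
        (g := fun θ : Real.Angle => (Δ θ.toReal : Real.Angle)) (hreal _ (hp x).2)
        (continuous_φ.comp (continuous_subtype_val.comp continuous_subtype_val)).continuousAt
    unfold r φ ψ w at *
    fun_prop
  have hg : Continuous g := by
    refine Continuous.subtype_mk (Continuous.subtype_mk ?_ _) _
    have h1 : Continuous fun x : bMinus Φ (block h δ) =>
        (Δ (Real.pi - φ (x.1 : PhaseSpace)).toReal : Real.Angle) :=
      continuous_iff_continuousAt.2 fun x => ContinuousAt.comp
        (g := fun θ : Real.Angle => (Δ θ.toReal : Real.Angle))
        (hreal _ (by rw [hcos]; exact neg_nonneg.2 (hm x).2))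
        (continuous_const.sub (continuous_φ.comp
          (continuous_subtype_val.comp continuous_subtype_val))).continuousAt
    unfold r φ ψ w at *
    fun_prop
  refine ⟨⟨⟨f, g, fun x => ?_, fun x => ?_⟩, hf, hg⟩, fun x hx => ?_, fun x hx => ?_⟩
  · refine Subtype.ext (Subtype.ext ?_)
    simp [f, g, r, φ, ψ, w]
  · refine Subtype.ext (Subtype.ext ?_)
    simp [f, g, r, φ, ψ, w]
  · refine Subtype.ext ?_
    rw [mapAcross_eq hΦ hδ hF hFκ (hp x).1 (hp x).2
      (fun h0 => hx ((aPlus_block hΦ hδ).superset ⟨(hp x).1, h0⟩)), hΔ]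
    rfl
  · have h0 : φ (x.1 : PhaseSpace) = 0 := ((aPlus_block hΦ hδ).subset hx).2
    change (_, _, _, _) = _
    rw [h0, (hp x).1, sub_zero, Real.Angle.toReal_zero, hΔ0, Real.Angle.coe_zero, add_zero]

end LogCentralForce

theorem mainTheorem1 (h : ℝ) :
    -- the regularised equations have a unique complete flow on the energy level
    (∃! Φ : Flow ℝ (LogCentralForce.energySurface h), LogCentralForce.IsRegularisedFlow h Φ) ∧
    (∀ Φ : Flow ℝ (LogCentralForce.energySurface h), LogCentralForce.IsRegularisedFlow h Φ →
      LogCentralForce.IsBlowUpOfLogProblem h Φ ∧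
      ∃ δ₀ : ℝ, 0 < δ₀ ∧ ∀ δ : ℝ, 0 < δ → δ ≤ δ₀ →
        LogCentralForce.IsIsolatingBlock Φ (LogCentralForce.block h δ) ∧
        LogCentralForce.Isolates Φ (LogCentralForce.block h δ)
          (LogCentralForce.collisionManifold h) ∧
        frontier (LogCentralForce.block h δ) = {x | x.1.r = δ} ∧
        LogCentralForce.bPlus Φ (LogCentralForce.block h δ) =
          {x | x.1.r = δ ∧ 0 ≤ x.1.φ.cos} ∧
        LogCentralForce.bMinus Φ (LogCentralForce.block h δ) =
          {x | x.1.r = δ ∧ x.1.φ.cos ≤ 0} ∧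
        LogCentralForce.aPlus Φ (LogCentralForce.block h δ) =
          {x | x.1.r = δ ∧ x.1.φ = 0} ∧
        LogCentralForce.aMinus Φ (LogCentralForce.block h δ) =
          {x | x.1.r = δ ∧ x.1.φ = (Real.pi : Real.Angle)} ∧
        -- the map across the block extends to a homeomorphism, by `φ = 0 ↦ φ = π`
        ∃ e : LogCentralForce.bPlus Φ (LogCentralForce.block h δ) ≃ₜ
            LogCentralForce.bMinus Φ (LogCentralForce.block h δ),
          LogCentralForce.ExtendsMapAcross Φ (LogCentralForce.block h δ) e ∧
          ∀ x, x.1 ∈ LogCentralForce.aPlus Φ (LogCentralForce.block h δ) →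
            (e x).1.1 = (δ, (Real.pi : Real.Angle), x.1.1.ψ, x.1.1.w)) ∧
    LogCentralForce.IsBlockRegularisable h := by
  obtain ⟨δ₀, hδ₀, hsmall⟩ := LogCentralForce.exists_isSmall h
  refine ⟨LogCentralForce.existsUnique_flow h, fun Φ hΦ =>
    ⟨LogCentralForce.isBlowUpOfLogProblem hΦ, δ₀, hδ₀, fun δ hpos hle => ?_⟩, ?_⟩
  · have hδ := hsmall δ hpos hle
    exact ⟨LogCentralForce.isIsolatingBlock_block hΦ hδ, LogCentralForce.isolates_block hΦ hδ,
      LogCentralForce.frontier_block hΦ hδ, LogCentralForce.bPlus_block hΦ hδ,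
      LogCentralForce.bMinus_block hΦ hδ, LogCentralForce.aPlus_block hΦ hδ,
      LogCentralForce.aMinus_block hΦ hδ, LogCentralForce.exists_homeomorph_mapAcross hΦ hδ⟩
  · obtain ⟨Φ, hΦ, -⟩ := LogCentralForce.existsUnique_flow h
    have hδ := hsmall δ₀ hδ₀ le_rfl
    obtain ⟨e, he, -⟩ := LogCentralForce.exists_homeomorph_mapAcross hΦ hδ
    exact ⟨Φ, hΦ, LogCentralForce.isBlowUpOfLogProblem hΦ, _,
      LogCentralForce.isIsolatingBlock_block hΦ hδ, LogCentralForce.isolates_block hΦ hδ, e, he⟩
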